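/- Let $n\geq 1$ (for $n=1$ the manifolds below are single points, and the curvatures and the empty sums in the formulas are read as $0$). Let $f:\left]0,1\right[\to\mathbb R$ be admissible, i.e. $f$ has an analytic extension to a neighbourhood of $\left]0,1\right[$ in $\mathbb C$ and $f'(x)\neq 0$ for all $x\in\left]0,1\right[$. Let $\mathcal M_n$ be the set of real (respectively complex) self-adjoint positive definite $n\times n$ matrices with trace $1$, and let $g_f$ be the Riemannian metric on $\mathcal M_n$ that is the pull-back, along $D\mapsto f(D)$, of the Euclidean metric $(X,Y)\mapsto\operatorname{Tr}XY$ of the space of self-adjoint matrices, so that $g_f(D)(X,Y)=\operatorname{Tr}\bigl(df(D)(X)\,df(D)(Y)\bigr)$. For $D\in\mathcal M_n$ with eigenvalues $\lambda_1,\dots,\lambda_n$ (with multiplicity) put $$M_{ii}=f'(\lambda_i),\qquad M_{iii}=\tfrac12 f''(\lambda_i),\qquad c=\sqrt{\sum_{k=1}^n\frac1{f'(\lambda_k)^2}},$$ $$\rho_{ij}=-\frac{1}{f'(\lambda_i)f'(\lambda_j)}\,\frac{f'(\lambda_i)-f'(\lambda_j)}{f(\lambda_i)-f(\lambda_j)}\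 \text{ if }\lambda_i\ne\lambda_j,\qquad \rho_{ij}=-\frac{f''(\lambda_i)}{f'(\lambda_i)^3}\ \text{ if }\lambda_i=\lambda_j,$$ $$A=\sum_{i\ne k}\frac{M_{iii}M_{kkk}}{M_{ii}^3M_{kk}^3}\Bigl(c^2-\frac1{M_{ii}^2}-\frac1{M_{kk}^2}\Bigr),\qquad B=\sum_{k}\frac{M_{kkk}}{M_{kk}^3}\Bigl(c^2-\frac1{M_{kk}^2}\Bigr),\qquad P=\sum_{i<j}\rho_{ij},\qquad Q=\sum_{i<j}\rho_{ij}^2 .$$ (1) The scalar curvature of $(\mathcal M_n,g_f)$ at $D$ is, for real matrices and for complex matrices respectively, $$\operatorname{Scal}(D)_{\mathbb R}=\frac4{c^4}\bigl(A-BP\bigr)+\frac{P^2}{c^2}-\frac{Q}{c^2},\qquad \operatorname{Scal}(D)_{\mathbb C}=\frac4{c^4}\bigl(A-2BP\bigr)+\frac{4P^2}{c^2}-\frac{2Q}{c^2}.$$ (2) The submanifold of diagonal matrices in $\mathcal M_n$, with the restriction of $g_f$, has at a diagonal state $D$ (whose eigenvalues are $\lambda_i=D_{ii}$) the scalar curvature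 $\dfrac{4}{c^4}A$. (3) For every $\alpha\in\mathbb R$, including $\alpha=1$, let $\mathcal P_n=\{\vartheta\in\mathbb R^n:\vartheta_k>0,\ \sum_k\vartheta_k=1\}$ carry the pull-back $g_\alpha$ of the canonical metric of $\mathbb R^n$ along $\vartheta\mapsto\frac{2}{1-\alpha}\bigl(\vartheta_1^{(1-\alpha)/2},\dots,\vartheta_n^{(1-\alpha)/2}\bigr)$ if $\alpha\ne1$ and along $\vartheta\mapsto(\log\vartheta_1,\dots,\log\vartheta_n)$ if $\alpha=1$. The scalar curvature of $(\mathcal P_n,g_\alpha)$ at $\vartheta$ is $$\operatorname{Scal}(\vartheta)=\frac{(1+\alpha)^2}{4c(\vartheta)^2}\sum_{t\ne s}\vartheta_t^\alpha\vartheta_s^\alpha\Bigl(1-\frac{\vartheta_t^{\alpha+1}+\vartheta_s^{\alpha+1}}{c(\vartheta)^2}\Bigr),\qquad c(\vartheta)=\sqrt{\sum_k\vartheta_k^{\alpha+1}} .$$ -/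

import Mathlib

noncomputable section

/-! ### Riemannian metrics on open subsets of an affine space

Let `T` be a finite-dimensional subspace of a real vector space `E`. A metric on a relatively open
subset of an affine subspace `p₀ + T` is a function `g`, where `g p X Y` is the scalar product
at `p` of the tangent vectors `X, Y ∈ T`. A basis `b` of `T` gives affine coordinates
`x ↦ p₀ + ∑ xᵢ bᵢ`, and the partial derivative `∂ᵢ` in these coordinates is the derivative along
the line `t ↦ p + t bᵢ`. The notions below are the classical ones in these coordinates. -/

section Riemannian

variable {E : Type*} [AddCommGroup E] [Module ℝ E]

/-- The derivative at `p` of a map `φ` in the direction `X`. -/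
def dirDeriv {F : Type*} [AddCommGroup F] [Module ℝ F] [TopologicalSpace F]
    (φ : E → F) (p X : E) : F :=
  deriv (fun t : ℝ => φ (p + t • X)) 0

/-- The pull-back along `φ` of the constant metric `B` of a vector space `F`. -/
def pullbackMetric {F : Type*} [AddCommGroup F] [Module ℝ F] [TopologicalSpace F]
    (B : F → F → ℝ) (φ : E → F) (p X Y : E) : ℝ :=
  B (dirDeriv φ p X) (dirDeriv φ p Y)

variable {T : Submodule ℝ E} {d : ℕ} (b : Module.Basis (Fin d) ℝ T) (g : E → E → E → ℝ)

/-- The partial derivative `∂ᵢ u` in the coordinates given by `b`. -/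
def partialDeriv (i : Fin d) (u : E → ℝ) (p : E) : ℝ :=
  dirDeriv u p (b i : E)

/-- The metric tensor `g_ij`. -/
def metricTensor (p : E) : Matrix (Fin d) (Fin d) ℝ :=
  Matrix.of fun i j => g p (b i : E) (b j : E)

/-- The Christoffel symbol `Γ_ij^k` of the Levi-Civita connection, so that
`∇_{∂ᵢ} ∂ⱼ = ∑ₖ Γ_ij^k ∂ₖ`. -/
def christoffel (i j k : Fin d) (p : E) : ℝ :=
  (1 / 2) * ∑ m, (metricTensor b g p)⁻¹ k m *
    (partialDeriv b i (fun q => metricTensor b g q j m) p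
      + partialDeriv b j (fun q => metricTensor b g q i m) p
      - partialDeriv b m (fun q => metricTensor b g q i j) p)

/-- The component `R_ijk^l` of the Riemannian curvature tensor
`R(X, Y) Z = ∇_X ∇_Y Z - ∇_Y ∇_X Z - ∇_[X,Y] Z`, so that `R(∂ᵢ, ∂ⱼ) ∂ₖ = ∑ₗ R_ijk^l ∂ₗ`. -/
def riemannTensor (i j k l : Fin d) (p : E) : ℝ :=
  partialDeriv b i (christoffel b g j k l) p - partialDeriv b j (christoffel b g i k l) p
    + ∑ m, (christoffel b g j k m p * christoffel b g i m l p
        - christoffel b g i k m p * christoffel b g j m l p)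

/-- The Ricci tensor `Ric_jk`, where `Ric(Y, Z)` is the trace of `X ↦ R(X, Y) Z`. -/
def ricciTensor (j k : Fin d) (p : E) : ℝ :=
  ∑ i, riemannTensor b g i j k i p

/-- The scalar curvature `∑ g^{jk} Ric_jk`; equivalently `∑ g(R(A_t, A_s) A_s, A_t)` over an
orthonormal basis `(A_t)` of the tangent space. -/
def scalarCurvature (p : E) : ℝ :=
  ∑ j, ∑ k, (metricTensor b g p)⁻¹ j k * ricciTensor b g j k p

end Riemannian

/-! ### State spaces and their pull-back geometries -/

/-- A function `f : ]0,1[ → ℝ` is admissible if it has an analytic extension to a neighbourhood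
of `]0,1[` in the complex plane and `f'` does not vanish on `]0,1[`.
The values of `f` outside `]0,1[` are arbitrary. -/
def Admissible (f : ℝ → ℝ) : Prop :=
  (∃ (U : Set ℂ) (F : ℂ → ℂ), IsOpen U ∧ (∀ x ∈ Set.Ioo (0 : ℝ) 1, (x : ℂ) ∈ U) ∧
      DifferentiableOn ℂ F U ∧ ∀ x ∈ Set.Ioo (0 : ℝ) 1, F (x : ℂ) = (f x : ℂ)) ∧
    ∀ x ∈ Set.Ioo (0 : ℝ) 1, deriv f x ≠ 0

section Quantum

open scoped ComplexOrder

variable (𝕜 : Type) [RCLike 𝕜] (n : ℕ)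

/-- The space `M_n` of real or complex positive definite matrices with trace one. -/
def stateSpace : Set (Matrix (Fin n) (Fin n) 𝕜) :=
  {D | D.PosDef ∧ D.trace = 1}

variable {𝕜 n} in
theorem stateSpace.isHermitian {D : Matrix (Fin n) (Fin n) 𝕜} (hD : D ∈ stateSpace 𝕜 n) :
    D.IsHermitian :=
  hD.1.isHermitian

/-- The tangent space of `M_n`: the self-adjoint matrices with trace zero. -/
def stateTangent : Submodule ℝ (Matrix (Fin n) (Fin n) 𝕜) where
  carrier := {X | X.IsHermitian ∧ X.trace = 0}
  zero_mem' := ⟨Matrix.isHermitian_zero, Matrix.trace_zero _ _⟩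
  add_mem' := fun {X Y} hX hY => ⟨hX.1.add hY.1, by rw [Matrix.trace_add, hX.2, hY.2, add_zero]⟩
  smul_mem' := fun r X hX => ⟨by
    unfold Matrix.IsHermitian
    rw [Matrix.conjTranspose_smul, hX.1.eq, star_trivial], by
    rw [Matrix.trace_smul, hX.2, smul_zero]⟩

/-- The tangent space of the space of diagonal states: the diagonal self-adjoint matrices with
trace zero. -/
def diagTangent : Submodule ℝ (Matrix (Fin n) (Fin n) 𝕜) where
  carrier := {X | X ∈ stateTangent 𝕜 n ∧ X.IsDiag}
  zero_mem' := ⟨Submodule.zero_mem _, Matrix.isDiag_zero⟩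
  add_mem' := fun hX hY => ⟨Submodule.add_mem _ hX.1 hY.1, hX.2.add hY.2⟩
  smul_mem' := fun r _ hX => ⟨Submodule.smul_mem _ r hX.1, hX.2.smul r⟩

variable {𝕜 n}

/-- The Euclidean metric `Tr XY` of the space of self-adjoint matrices. -/
def traceMetric (X Y : Matrix (Fin n) (Fin n) 𝕜) : ℝ :=
  RCLike.re (X * Y).trace

/-- The metric `g_f`: the pull-back of the Euclidean metric along `D ↦ f(D)`, where `f(D)` is given
by the functional calculus of self-adjoint matrices. -/
def gf (f : ℝ → ℝ) (D X Y : Matrix (Fin n) (Fin n) 𝕜) : ℝ :=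
  pullbackMetric traceMetric (fun A : Matrix (Fin n) (Fin n) 𝕜 => cfc f A) D X Y

end Quantum

section Classical

/-- The space `P_n` of strictly positive probability distributions on `n` points. -/
def probSpace (n : ℕ) : Set (Fin n → ℝ) :=
  {θ | (∀ k, 0 < θ k) ∧ ∑ k, θ k = 1}

/-- The tangent space of `P_n`. -/
def probTangent (n : ℕ) : Submodule ℝ (Fin n → ℝ) where
  carrier := {a | ∑ k, a k = 0}
  zero_mem' := by simp
  add_mem' := fun {a c} (ha : ∑ k, a k = 0) (hc : ∑ k, c k = 0) => by
    simp [Finset.sum_add_distrib, ha, hc]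
  smul_mem' := fun r a (ha : ∑ k, a k = 0) => by
    simp [← Finset.mul_sum, ha]

/-- The function which defines the `α`-geometry. -/
def alphaFun (α x : ℝ) : ℝ :=
  if α = 1 then Real.log x else 2 / (1 - α) * x ^ ((1 - α) / 2)

/-- The metric `g_α` of the `α`-geometry of `P_n`: the pull-back of the canonical metric of `ℝⁿ`
along `θ ↦ (alphaFun α θ₁, …, alphaFun α θₙ)`. -/
def gAlpha {n : ℕ} (α : ℝ) (θ X Y : Fin n → ℝ) : ℝ :=
  pullbackMetric (fun x y : Fin n → ℝ => ∑ i, x i * y i)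
    (fun (η : Fin n → ℝ) (i : Fin n) => alphaFun α (η i)) θ X Y

end Classical

/-! ### The quantities in the curvature formulas -/

section Formulas

/-- `M_ii = f'(λᵢ)`, as a function of `λᵢ`. -/
def M₂ (f : ℝ → ℝ) (x : ℝ) : ℝ := deriv f x

/-- `M_iii = f''(λᵢ) / 2`, as a function of `λᵢ`. -/
def M₃ (f : ℝ → ℝ) (x : ℝ) : ℝ := deriv (deriv f) x / 2

/-- `ρ_ij`, as a function of `λᵢ` and `λⱼ`. -/
def rho (f : ℝ → ℝ) (x y : ℝ) : ℝ :=
  if x = y then -(deriv (deriv f) x / deriv f x ^ 3)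
  else -(1 / (deriv f x * deriv f y) * ((deriv f x - deriv f y) / (f x - f y)))

variable {n : ℕ} (f : ℝ → ℝ) (l : Fin n → ℝ)

/-- `c = √(∑ₖ 1 / f'(λₖ)²)`. -/
def cNorm : ℝ := √(∑ k, 1 / deriv f (l k) ^ 2)

/-- The sum over all `i ≠ k` of
`M_iii M_kkk / (M_ii³ M_kk³) (c² - 1 / M_ii² - 1 / M_kk²)`. -/
def diagDoubleSum : ℝ :=
  ∑ i, ∑ k ∈ Finset.univ.erase i,
    M₃ f (l i) * M₃ f (l k) / (M₂ f (l i) ^ 3 * M₂ f (l k) ^ 3) *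
      (cNorm f l ^ 2 - 1 / M₂ f (l i) ^ 2 - 1 / M₂ f (l k) ^ 2)

/-- The sum over all `k` of `M_kkk / M_kk³ (c² - 1 / M_kk²)`. -/
def diagSum : ℝ :=
  ∑ k, M₃ f (l k) / M₂ f (l k) ^ 3 * (cNorm f l ^ 2 - 1 / M₂ f (l k) ^ 2)

/-- The sum over all `i < j` of `ρ_ij`. -/
def rhoSum : ℝ := ∑ i, ∑ j ∈ Finset.Ioi i, rho f (l i) (l j)

/-- The sum over all `i < j` of `ρ_ij²`. -/
def rhoSqSum : ℝ := ∑ i, ∑ j ∈ Finset.Ioi i, rho f (l i) (l j) ^ 2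

end Formulas

end

/-! By construction `f` maps the state space isometrically onto a hypersurface of a Euclidean space,
the self-adjoint matrices with `Tr XY`. So the whole computation is the Gauss equation for a
hypersurface, provided that a normal field and its derivative are known.

The normal field is `N = (1/f')(D)`. In an eigenbasis of `D` the diagonal entries of `df(D)(X)` are
`f'(λᵢ) Xᵢᵢ`, hence `Tr(df(D)(X) N) = Tr X`, which vanishes on tangent vectors; also `|N|² = c²`
(`traceMetric_cfcDeriv_cfc_inv_deriv`). In that eigenbasis the derivative of any functional calculus
multiplies the `(i,j)` entry by a divided difference (`hasDerivAt_inEigenbasis_cfc`). Both `df(D)`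
and `dN(D)` are therefore diagonal in the real coordinates of the matrix entries, and the ratio of
their factors is exactly `ρᵢⱼ` (`dslope_inv_deriv`). Up to the factor `-1/c`, the shape operator is
the diagonal operator `ρ` compressed to the orthogonal complement of `N`.

`scalarCurvature_hypersurface` evaluates `((tr)² - tr of the square) / c²` for such a compression.
Since `N` has only the components `1/f'(λₖ)` on the diagonal, the off-diagonal directions enter
through plain sums of `ρ` and `ρ²`, each pair `i < j` counted once over `ℝ` and twice over `ℂ`;
`curvature_formula` rewrites the diagonal contribution as `A` and `B`. For diagonal states and for
the `α`-geometry there are no off-diagonal directions and only the term with `A` remains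
(`scalarCurvature_coordinatewise`).

The analytic input is that `D ↦ f(D)` is smooth, also where eigenvalues coincide. It comes from
Cauchy integrals of the resolvent around the spectrum (`contDiffAt_cfc_apply_complex`), and this is
where the holomorphic extension is used. For `n = 1` the eigenvalue is `1`, outside the domain of
`f`, but the tangent space is zero. -/

open Filter Topology

noncomputable section

/-! ### The Gauss equation in affine coordinates. -/

section Gauss

variable {E : Type*} [AddCommGroup E] [Module ℝ E] {T : Submodule ℝ E} {d : ℕ}
  (b : Module.Basis (Fin d) ℝ T)

/-- The affine coordinates around `p` given by a basis `b` of the direction `T`. -/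
def affineChart (p : E) (x : Fin d → ℝ) : E := p + ∑ i, x i • (b i : E)

@[simp]
theorem affineChart_zero (p : E) : affineChart b p 0 = p := by
  simp [affineChart]

theorem affineChart_add_single (p : E) (x : Fin d → ℝ) (i : Fin d) (t : ℝ) :
    affineChart b p (x + t • Pi.single i 1) = affineChart b p x + t • (b i : E) := by
  simp only [affineChart, Pi.add_apply, Pi.smul_apply, add_smul, Finset.sum_add_distrib, add_assoc]
  congr 2
  rw [Finset.sum_eq_single i] <;> simp +contextual

-- `E` carries no topology, so calculus is done on `ℝᵈ`: a line in the direction of a basis vector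
-- is the image of a coordinate line. Agreement near `x` is enough, which allows formulas valid only
-- near the base point.
variable {b} in
theorem dirDeriv_affineChart {F : Type*} [NormedAddCommGroup F] [NormedSpace ℝ F]
    {p : E} {u : E → F} {v : (Fin d → ℝ) → F} {x : Fin d → ℝ}
    (h : (fun y => u (affineChart b p y)) =ᶠ[𝓝 x] v) (hv : DifferentiableAt ℝ v x) (i : Fin d) :
    dirDeriv u (affineChart b p x) (b i : E) = fderiv ℝ v x (Pi.single i 1) := by
  have h1 : (fun t : ℝ => u (affineChart b p x + t • (b i : E)))
      =ᶠ[𝓝 0] fun t : ℝ => v (x + t • Pi.single i 1) := by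
    have hc : Tendsto (fun t : ℝ => x + t • (Pi.single i 1 : Fin d → ℝ)) (𝓝 0) (𝓝 x) := by
      have : Continuous fun t : ℝ => x + t • (Pi.single i 1 : Fin d → ℝ) := by fun_prop
      simpa using this.tendsto 0
    filter_upwards [hc.eventually h] with t ht
    rw [← ht, affineChart_add_single]
  rw [dirDeriv, h1.deriv_eq]
  exact hv.lineDeriv_eq_fderiv

theorem fderiv_dotProduct_apply {ι X : Type*} [Fintype ι] [NormedAddCommGroup X] [NormedSpace ℝ X]
    {u v : X → ι → ℝ} {x : X} (hu : DifferentiableAt ℝ u x) (hv : DifferentiableAt ℝ v x) (w : X) :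
    fderiv ℝ (fun z => u z ⬝ᵥ v z) x w
      = fderiv ℝ u x w ⬝ᵥ v x + u x ⬝ᵥ fderiv ℝ v x w := by
  have hu' := fun a => hasFDerivAt_pi'.1 hu.hasFDerivAt a
  have hv' := fun a => hasFDerivAt_pi'.1 hv.hasFDerivAt a
  have := (HasFDerivAt.fun_sum fun (a : ι) (_ : a ∈ Finset.univ) => (hu' a).fun_mul (hv' a)).fderiv
  simp only [dotProduct]
  rw [this]
  simp only [FunLike.coe_sum, Finset.sum_apply, _root_.add_apply,
    _root_.smul_apply, ContinuousLinearMap.coe_comp, Function.comp_apply,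
    ContinuousLinearMap.proj_apply, smul_eq_mul, ← Finset.sum_add_distrib]
  exact Finset.sum_congr rfl fun a _ => by ring

theorem DifferentiableAt.dotProduct {ι X : Type*} [Fintype ι] [NormedAddCommGroup X]
    [NormedSpace ℝ X] {u v : X → ι → ℝ} {x : X} (hu : DifferentiableAt ℝ u x)
    (hv : DifferentiableAt ℝ v x) : DifferentiableAt ℝ (fun z => u z ⬝ᵥ v z) x := by
  have hu' := differentiableAt_pi.1 hu
  have hv' := differentiableAt_pi.1 hv
  simp only [_root_.dotProduct]
  exact DifferentiableAt.fun_sum fun a _ => (hu' a).mul (hv' a)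

section MatrixSmooth

variable {m X 𝔸 : Type*} [Fintype m] [DecidableEq m] [NormedAddCommGroup X] [NormedSpace ℝ X]
  [NormedField 𝔸] [NormedAlgebra ℝ 𝔸] {N : WithTop ℕ∞} {G : X → Matrix m m 𝔸} {x : X}

theorem ContDiffAt.matrix_det (hG : ∀ i j, ContDiffAt ℝ N (fun z => G z i j) x) :
    ContDiffAt ℝ N (fun z => (G z).det) x := by
  simp only [Matrix.det_apply']
  exact ContDiffAt.sum fun σ _ => contDiffAt_const.mul (contDiffAt_prod fun k _ => hG _ _)

theorem ContDiffAt.matrix_adjugate_apply (hG : ∀ i j, ContDiffAt ℝ N (fun z => G z i j) x)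
    (i j : m) : ContDiffAt ℝ N (fun z => (G z).adjugate i j) x := by
  simp only [Matrix.adjugate_apply]
  refine ContDiffAt.matrix_det fun k l => ?_
  by_cases hk : k = j
  · simpa [Matrix.updateRow_apply, hk] using contDiffAt_const
  · simpa [Matrix.updateRow_apply, hk] using hG k l

/-- The entries of the inverse of an invertible matrix depend smoothly on the matrix. -/
theorem ContDiffAt.matrix_inv_apply (hG : ∀ i j, ContDiffAt ℝ N (fun z => G z i j) x)
    (hdet : (G x).det ≠ 0) (i j : m) : ContDiffAt ℝ N (fun z => (G z)⁻¹ i j) x := by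
  simp only [Matrix.inv_def, Ring.inverse_eq_inv', Matrix.smul_apply, smul_eq_mul]
  exact ((ContDiffAt.matrix_det hG).inv hdet).mul (ContDiffAt.matrix_adjugate_apply hG i j)

end MatrixSmooth

/-- The partial derivatives of a map on `ℝᵈ`. -/
def pderiv {F : Type*} [NormedAddCommGroup F] [NormedSpace ℝ F] (i : Fin d)
    (y : (Fin d → ℝ) → F) (x : Fin d → ℝ) : F :=
  fderiv ℝ y x (Pi.single i 1)

theorem ContDiffAt.pderiv {F : Type*} [NormedAddCommGroup F] [NormedSpace ℝ F]
    {y : (Fin d → ℝ) → F} {x : Fin d → ℝ} {m n : WithTop ℕ∞} (hy : ContDiffAt ℝ n y x)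
    (hmn : m + 1 ≤ n) (i : Fin d) : ContDiffAt ℝ m (pderiv i y) x :=
  (hy.fderiv_right hmn).clm_apply contDiffAt_const

theorem pderiv_comm {F : Type*} [NormedAddCommGroup F] [NormedSpace ℝ F]
    {y : (Fin d → ℝ) → F} {x : Fin d → ℝ} (hy : ContDiffAt ℝ 2 y x) (i j : Fin d) :
    pderiv i (pderiv j y) x = pderiv j (pderiv i y) x := by
  have hs := hy.isSymmSndFDerivAt (by simp)
  have hd : DifferentiableAt ℝ (fderiv ℝ y) x :=
    (hy.fderiv_right (m := 1) (by norm_num)).differentiableAt (by norm_num)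
  have key : ∀ i j : Fin d, pderiv i (pderiv j y) x
      = fderiv ℝ (fderiv ℝ y) x (Pi.single i 1) (Pi.single j 1) := by
    intro i j
    unfold pderiv
    rw [fderiv_clm_apply hd (by fun_prop)]
    simp
  rw [key, key, hs.eq]

variable {ι : Type*} [Fintype ι] (g : E → E → E → ℝ) (y : (Fin d → ℝ) → ι → ℝ)

/-- The Gram matrix of the partial derivatives of `y`. -/
def gramOf (x : Fin d → ℝ) : Matrix (Fin d) (Fin d) ℝ :=
  Matrix.of fun i j => pderiv i y x ⬝ᵥ pderiv j y x

/-- The Christoffel symbols of the metric induced by an immersion `y`. -/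
def gammaOf (i j k : Fin d) (x : Fin d → ℝ) : ℝ :=
  ∑ m, (gramOf y x)⁻¹ k m * (pderiv i (pderiv j y) x ⬝ᵥ pderiv m y x)

variable {b g y} {p : E}
  (hy : ContDiffAt ℝ 3 y 0)
  (hg : ∀ᶠ x in 𝓝 0, ∀ i j, g (affineChart b p x) (b i) (b j) = pderiv i y x ⬝ᵥ pderiv j y x)

include hg in
theorem metricTensor_affineChart :
    ∀ᶠ x in 𝓝 0, metricTensor b g (affineChart b p x) = gramOf y x := by
  filter_upwards [hg] with x hx
  ext i j
  simp [metricTensor, gramOf, hx]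

include hy hg in
theorem partialDeriv_metricTensor_affineChart :
    ∀ᶠ x in 𝓝 0, ∀ i j k,
      partialDeriv b i (fun q => metricTensor b g q j k) (affineChart b p x) =
        pderiv i (pderiv j y) x ⬝ᵥ pderiv k y x + pderiv j y x ⬝ᵥ pderiv i (pderiv k y) x := by
  filter_upwards [(metricTensor_affineChart hg).eventually_nhds, hy.eventually (by simp)]
    with x hx hyx i j k
  have hd : ∀ l, DifferentiableAt ℝ (pderiv l y) x := fun l =>
    (hyx.pderiv (m := 2) (by norm_num) l).differentiableAt (by norm_num)
  have := dirDeriv_affineChart (u := fun q => metricTensor b g q j k)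
    (v := fun z => pderiv j y z ⬝ᵥ pderiv k y z) (b := b)
    (p := p) (hx.mono fun z hz => by simp only [hz]; rfl) ((hd j).dotProduct (hd k)) i
  rw [partialDeriv, this, fderiv_dotProduct_apply (hd j) (hd k)]
  rfl

-- Of the six terms obtained by differentiating the inner products `⟨∂ⱼy, ∂ₘy⟩`, symmetry of second
-- derivatives cancels four; the other two are both `⟨∂ᵢ∂ⱼy, ∂ₘy⟩`.
include hy hg in
theorem christoffel_affineChart :
    ∀ᶠ x in 𝓝 0, ∀ i j k, christoffel b g i j k (affineChart b p x) = gammaOf y i j k x := by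
  filter_upwards [metricTensor_affineChart hg, partialDeriv_metricTensor_affineChart hy hg,
    hy.eventually (by simp)] with x hx hx' hyx i j k
  rw [christoffel, gammaOf, Finset.mul_sum]
  refine Finset.sum_congr rfl fun m _ => ?_
  have h2 : ContDiffAt ℝ 2 y x := hyx.of_le (by norm_num)
  rw [hx, hx', hx', hx', pderiv_comm h2 j i, pderiv_comm h2 m i, pderiv_comm h2 m j,
    dotProduct_comm (pderiv i y x), dotProduct_comm (pderiv j y x) (pderiv i (pderiv m y) x)]
  ring

theorem gramOf_mul_gammaOf {x : Fin d → ℝ} (hdet : (gramOf y x).det ≠ 0) (i j m : Fin d) :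
    ∑ l, gramOf y x m l * gammaOf y i j l x = pderiv i (pderiv j y) x ⬝ᵥ pderiv m y x := by
  have h : ∀ l, gammaOf y i j l x
      = (gramOf y x)⁻¹.mulVec (fun m => pderiv i (pderiv j y) x ⬝ᵥ pderiv m y x) l := fun l => rfl
  simp only [h]
  have := Matrix.mulVec_mulVec (fun m => pderiv i (pderiv j y) x ⬝ᵥ pderiv m y x)
    (gramOf y x) (gramOf y x)⁻¹
  rw [Matrix.mul_nonsing_inv _ (Ne.isUnit hdet), Matrix.one_mulVec] at this
  exact congrFun this m

include hy in
theorem contDiffAt_gramOf (i j : Fin d) : ContDiffAt ℝ 1 (fun z => gramOf y z i j) 0 := by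
  have hd : ∀ l a, ContDiffAt ℝ 1 (fun z => pderiv l y z a) 0 := fun l a =>
    contDiffAt_pi.1 (hy.pderiv (by norm_num) l) a
  exact ContDiffAt.sum fun a _ => (hd i a).mul (hd j a)

include hy in
theorem differentiableAt_gammaOf (hdet : (gramOf y 0).det ≠ 0) (i j k : Fin d) :
    DifferentiableAt ℝ (gammaOf y i j k) 0 := by
  have hd : ∀ l, DifferentiableAt ℝ (pderiv l y) 0 := fun l =>
    (hy.pderiv (m := 2) (by norm_num) l).differentiableAt (by norm_num)
  have hd2 : DifferentiableAt ℝ (pderiv i (pderiv j y)) 0 :=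
    ((hy.pderiv (m := 2) (by norm_num) j).pderiv (m := 1) (by norm_num) i).differentiableAt
      (by norm_num)
  exact DifferentiableAt.fun_sum fun m _ =>
    ((ContDiffAt.matrix_inv_apply (contDiffAt_gramOf hy) hdet k m).differentiableAt
      (by norm_num)).mul (hd2.dotProduct (hd m))

/-- The pairing of the normal parts of the second derivatives of `y`. -/
def normalPairing (y : (Fin d → ℝ) → ι → ℝ) (i j k m : Fin d) : ℝ :=
  pderiv j (pderiv k y) 0 ⬝ᵥ pderiv i (pderiv m y) 0
    - ∑ l, gammaOf y j k l 0 * (pderiv i (pderiv m y) 0 ⬝ᵥ pderiv l y 0)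

-- Differentiate the identity of `gramOf_mul_gammaOf` along `∂ᵢ`. The product rule on the Gram
-- matrix yields two terms: one is absorbed by the `ΓΓ` sum, the other turns `⟨∂ⱼ∂ₖy, ∂ᵢ∂ₘy⟩` into
-- the pairing of normal parts.
include hy in
theorem gramOf_mul_pderiv_gammaOf (hdet : (gramOf y 0).det ≠ 0) (i j k m : Fin d) :
    ∑ l, gramOf y 0 m l * (pderiv i (gammaOf y j k l) 0 +
        ∑ q, gammaOf y j k q 0 * gammaOf y i q l 0)
      = pderiv i (pderiv j (pderiv k y)) 0 ⬝ᵥ pderiv m y 0 + normalPairing y i j k m := by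
  have hd : ∀ l, DifferentiableAt ℝ (pderiv l y) 0 := fun l =>
    (hy.pderiv (m := 2) (by norm_num) l).differentiableAt (by norm_num)
  have hd2 : DifferentiableAt ℝ (pderiv j (pderiv k y)) 0 :=
    ((hy.pderiv (m := 2) (by norm_num) k).pderiv (m := 1) (by norm_num) j).differentiableAt
      (by norm_num)
  have hG := contDiffAt_gramOf hy
  have hev : ∀ᶠ x in 𝓝 0, (gramOf y x).det ≠ 0 :=
    (ContDiffAt.matrix_det hG).continuousAt.eventually_ne hdet
  have heq : (fun x => ∑ l, gramOf y x m l * gammaOf y j k l x)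
      =ᶠ[𝓝 0] fun x => pderiv j (pderiv k y) x ⬝ᵥ pderiv m y x :=
    hev.mono fun x hx => gramOf_mul_gammaOf hx j k m
  have h1 := congrArg (fun L : (Fin d → ℝ) →L[ℝ] ℝ => L (Pi.single i 1)) (heq.fderiv_eq (𝕜 := ℝ))
  rw [fderiv_dotProduct_apply hd2 (hd m),
    (HasFDerivAt.fun_sum fun (l : Fin d) (_ : l ∈ Finset.univ) =>
      ((hG m l).differentiableAt (by norm_num)).hasFDerivAt.fun_mul (differentiableAt_gammaOf hy hdet j k l).hasFDerivAt).fderiv] at h1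
  have h2 : ∀ l, fderiv ℝ (fun z => gramOf y z m l) 0 (Pi.single i 1)
      = pderiv i (pderiv m y) 0 ⬝ᵥ pderiv l y 0 + pderiv m y 0 ⬝ᵥ pderiv i (pderiv l y) 0 :=
    fun l => fderiv_dotProduct_apply (hd m) (hd l) _
  simp only [FunLike.coe_sum, Finset.sum_apply, _root_.add_apply,
    _root_.smul_apply, smul_eq_mul, h2, Finset.sum_add_distrib] at h1
  have h3 : ∑ l, gramOf y 0 m l * ∑ q, gammaOf y j k q 0 * gammaOf y i q l 0
      = ∑ q, gammaOf y j k q 0 * (pderiv m y 0 ⬝ᵥ pderiv i (pderiv q y) 0) := by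
    simp only [Finset.mul_sum]
    rw [Finset.sum_comm]
    refine Finset.sum_congr rfl fun q _ => ?_
    rw [dotProduct_comm, ← gramOf_mul_gammaOf hdet, Finset.mul_sum]
    exact Finset.sum_congr rfl fun l _ => by ring
  simp only [mul_add, Finset.sum_add_distrib] at h1 ⊢
  rw [h3, normalPairing]
  simp only [pderiv] at h1 ⊢
  linarith

include hy hg in
/-- The Gauss equation. -/
theorem riemannTensor_eq (hdet : (gramOf y 0).det ≠ 0) (i j k l : Fin d) :
    riemannTensor b g i j k l p = ∑ m, (gramOf y 0)⁻¹ l m *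
      (normalPairing y i j k m - normalPairing y j i k m) := by
  have hΓ := christoffel_affineChart hy hg
  have hΓ0 : ∀ i j k, christoffel b g i j k p = gammaOf y i j k 0 := by
    simpa using hΓ.self_of_nhds
  have hpd : ∀ i j k l, partialDeriv b i (christoffel b g j k l) p
      = pderiv i (gammaOf y j k l) 0 := by
    intro i j k l
    have := dirDeriv_affineChart (u := christoffel b g j k l) (b := b) (p := p)
      (v := gammaOf y j k l) (hΓ.mono fun z hz => hz j k l)
      (differentiableAt_gammaOf hy hdet j k l) i
    rwa [affineChart_zero] at this
  have hR : ∀ l, riemannTensor b g i j k l p =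
      (pderiv i (gammaOf y j k l) 0 + ∑ q, gammaOf y j k q 0 * gammaOf y i q l 0)
        - (pderiv j (gammaOf y i k l) 0 + ∑ q, gammaOf y i k q 0 * gammaOf y j q l 0) := by
    intro l
    simp only [riemannTensor, hpd, hΓ0, Finset.sum_sub_distrib]
    ring
  -- The third derivatives are tangential data that the curvature must not contain; they cancel
  -- under antisymmetrisation in `i, j`.
  have hsym : pderiv i (pderiv j (pderiv k y)) 0 = pderiv j (pderiv i (pderiv k y)) 0 :=
    pderiv_comm (hy.pderiv (by norm_num) k) i j
  have hlow : (gramOf y 0).mulVec (fun l => riemannTensor b g i j k l p)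
      = fun m => normalPairing y i j k m - normalPairing y j i k m := by
    funext m
    have h1 := gramOf_mul_pderiv_gammaOf hy hdet i j k m
    have h2 := gramOf_mul_pderiv_gammaOf hy hdet j i k m
    rw [← hsym] at h2
    simp only [Matrix.mulVec, dotProduct, hR, mul_sub, Finset.sum_sub_distrib]
    rw [h1, h2]
    ring
  have := congrArg (gramOf y 0)⁻¹.mulVec hlow
  rw [Matrix.mulVec_mulVec, Matrix.nonsing_inv_mul _ (Ne.isUnit hdet), Matrix.one_mulVec] at this
  exact congrFun this l

end Gauss

end

noncomputable section

/-! ### Scalar curvature of a hypersurface with diagonal normal derivative. -/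

section Hypersurface

/-- If the orthogonal complement of the rows of `e` is spanned by `N`, then the orthogonal
projection onto the span of the rows is `1 - N Nᵀ / |N|²`. -/
theorem transpose_mul_gram_inv_mul {ι κ : Type*} [Fintype ι] [DecidableEq ι] [Fintype κ]
    [DecidableEq κ] {e : Matrix κ ι ℝ} {N : ι → ℝ} (hdet : (e * e.transpose).det ≠ 0)
    (hN : N ⬝ᵥ N ≠ 0) (horth : e.mulVec N = 0)
    (hspan : ∀ v, e.mulVec v = 0 → ∃ s : ℝ, v = s • N) :
    e.transpose * (e * e.transpose)⁻¹ * e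
      = 1 - (N ⬝ᵥ N)⁻¹ • Matrix.vecMulVec N N := by
  set Q := e.transpose * (e * e.transpose)⁻¹ * e with hQ
  have hQT : Q.transpose = Q := by
    simp [hQ, Matrix.transpose_mul, Matrix.transpose_nonsing_inv, Matrix.mul_assoc]
  have heQ : e * Q = e := by
    rw [hQ, ← Matrix.mul_assoc, ← Matrix.mul_assoc, Matrix.mul_nonsing_inv _ (Ne.isUnit hdet),
      Matrix.one_mul]
  have hQN : Q.mulVec N = 0 := by
    rw [hQ, ← Matrix.mulVec_mulVec, horth, Matrix.mulVec_zero]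
  -- `Q` fixes the rows of `e`, so `v - Qv` is annihilated by `e` and is a multiple of `N`; pairing
  -- with `N` gives the coefficient.
  have key : ∀ v, v - Q.mulVec v = ((N ⬝ᵥ N)⁻¹ * (N ⬝ᵥ v)) • N := by
    intro v
    obtain ⟨s, hs⟩ := hspan (v - Q.mulVec v) (by
      rw [Matrix.mulVec_sub, Matrix.mulVec_mulVec, heQ, sub_self])
    have h1 : N ⬝ᵥ Q.mulVec v = 0 := by
      rw [Matrix.dotProduct_mulVec, ← Matrix.mulVec_transpose, hQT, hQN, zero_dotProduct]
    have h2 := congrArg (fun w => N ⬝ᵥ w) hs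
    simp only [dotProduct_sub, h1, sub_zero, dotProduct_smul, smul_eq_mul] at h2
    rw [hs, h2]
    congr 1
    field_simp
  ext c a
  have := congrFun (key (Pi.single a 1)) c
  simp only [Pi.sub_apply, Matrix.mulVec_single_one, Matrix.col_apply, dotProduct_single, mul_one,
    Pi.smul_apply, smul_eq_mul, Pi.single_apply] at this
  simp only [Matrix.sub_apply, Matrix.one_apply, Matrix.smul_apply, Matrix.vecMulVec_apply,
    smul_eq_mul]
  linarith

variable {E : Type*} [AddCommGroup E] [Module ℝ E] {T : Submodule ℝ E} {d : ℕ}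
  {b : Module.Basis (Fin d) ℝ T} {ι : Type*} [Fintype ι] {g : E → E → E → ℝ}
  {y N : (Fin d → ℝ) → ι → ℝ} {p : E} {ρ : ι → ℝ}

/-- The scalar curvature of a hypersurface of a Euclidean space with normal field `N`, at a point
where the derivative of `N` is given in orthonormal coordinates by a diagonal matrix. -/
theorem scalarCurvature_hypersurface [DecidableEq ι] (hy : ContDiffAt ℝ 3 y 0)
    (hg : ∀ᶠ x in 𝓝 0, ∀ i j,
      g (affineChart b p x) (b i) (b j) = pderiv i y x ⬝ᵥ pderiv j y x)
    (hli : LinearIndependent ℝ fun i => pderiv i y 0)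
    (hN : DifferentiableAt ℝ N 0) (horth : ∀ᶠ x in 𝓝 0, ∀ i, pderiv i y x ⬝ᵥ N x = 0)
    (hN0 : N 0 ⬝ᵥ N 0 ≠ 0)
    (hspan : ∀ v, (∀ i, pderiv i y 0 ⬝ᵥ v = 0) → ∃ s : ℝ, v = s • N 0)
    (hρ : ∀ i a, pderiv i N 0 a = ρ a * pderiv i y 0 a) :
    scalarCurvature b g p =
      ((∑ a, ρ a * (1 - (N 0 ⬝ᵥ N 0)⁻¹ * N 0 a ^ 2)) ^ 2
        - (∑ a, ρ a ^ 2 * (1 - 2 * (N 0 ⬝ᵥ N 0)⁻¹ * N 0 a ^ 2)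
          + (∑ a, ρ a * ((N 0 ⬝ᵥ N 0)⁻¹ * N 0 a ^ 2)) ^ 2)) / (N 0 ⬝ᵥ N 0) := by
  set e : Matrix (Fin d) ι ℝ := Matrix.of fun i => pderiv i y 0 with he
  set n := N 0 with hn
  set H : Matrix ι ι ℝ := Matrix.diagonal ρ with hH
  have hG : gramOf y 0 = e * e.transpose := by
    ext i j
    simp [gramOf, Matrix.mul_apply, he, dotProduct]
  have hdet : (e * e.transpose).det ≠ 0 := by
    have : (e * e.conjTranspose).PosDef :=
      Matrix.PosDef.mul_conjTranspose_self e (Matrix.vecMul_injective_iff.2 hli)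
    simpa using this.det_pos.ne'
  have hpr := transpose_mul_gram_inv_mul hdet hN0 (e := e)
    (funext fun i => horth.self_of_nhds i) (fun v hv => hspan v fun i => congrFun hv i)
  -- Differentiating `⟨∂ⱼy, N⟩ = 0` trades the second derivative of `y` for the known derivative of
  -- `N`. The field need not be normalised.
  have hh : ∀ i j, pderiv i (pderiv j y) 0 ⬝ᵥ n = -(e * H * e.transpose) i j := by
    intro i j
    have hz : (fun x => pderiv j y x ⬝ᵥ N x) =ᶠ[𝓝 0] fun _ => 0 := horth.mono fun x hx => hx j
    have h1 := congrArg (fun L : (Fin d → ℝ) →L[ℝ] ℝ => L (Pi.single i 1))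
      (hz.fderiv_eq (𝕜 := ℝ))
    rw [fderiv_dotProduct_apply ((hy.pderiv (m := 2) (by norm_num) j).differentiableAt
      (by norm_num)) hN] at h1
    simp only [fderiv_fun_const, Pi.zero_apply, _root_.zero_apply] at h1
    have h2 : pderiv j y 0 ⬝ᵥ pderiv i N 0 = (e * H * e.transpose) i j := by
      rw [Matrix.mul_apply, dotProduct]
      exact Finset.sum_congr rfl fun a _ => by
        simp [hH, Matrix.mul_diagonal, hρ, he]; ring
    rw [← h2]
    exact eq_neg_of_add_eq_zero_left h1
  set h := e * H * e.transpose with hhdef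
  have hhT : ∀ i j, h i j = h j i := by
    intro i j
    have : h.transpose = h := by
      simp [hhdef, hH, Matrix.transpose_mul, Matrix.mul_assoc]
    exact congrFun (congrFun this j) i
  have hnp : ∀ i j k m, normalPairing y i j k m = h j k * h i m * (n ⬝ᵥ n)⁻¹ := by
    intro i j k m
    set u := pderiv j (pderiv k y) 0
    set w := pderiv i (pderiv m y) 0
    have h1 : ∑ l, gammaOf y j k l 0 * (w ⬝ᵥ pderiv l y 0)
        = w ⬝ᵥ (e.transpose * (e * e.transpose)⁻¹ * e).mulVec u := by
      have : ∀ l, gammaOf y j k l 0 = ((e * e.transpose)⁻¹.mulVec (e.mulVec u)) l := by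
        intro l
        rw [gammaOf, hG, Matrix.mulVec, dotProduct]
        exact Finset.sum_congr rfl fun q _ => by rw [dotProduct_comm]; rfl
      simp only [this]
      rw [← Matrix.mulVec_mulVec, ← Matrix.mulVec_mulVec, Matrix.dotProduct_mulVec w,
        Matrix.vecMul_transpose, dotProduct_comm, dotProduct]
      exact Finset.sum_congr rfl fun q _ => by rw [dotProduct_comm w]; rfl
    have h2 : (Matrix.vecMulVec n n).mulVec u = (u ⬝ᵥ n) • n := by
      rw [Matrix.vecMulVec_mulVec, dotProduct_comm]
      simp
    rw [normalPairing, h1, hpr, Matrix.sub_mulVec, Matrix.one_mulVec, Matrix.smul_mulVec, h2,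
      dotProduct_sub, dotProduct_comm w u, sub_sub_cancel, dotProduct_smul, dotProduct_smul,
      hh, hh, smul_eq_mul, smul_eq_mul]
    ring
  have htr1 : ∑ j, ∑ k, (e * e.transpose)⁻¹ j k * h j k
      = ∑ a, ρ a * (1 - (n ⬝ᵥ n)⁻¹ * n a ^ 2) := by
    have : ∑ j, ∑ k, (e * e.transpose)⁻¹ j k * h j k = ((e * e.transpose)⁻¹ * h).trace := by
      simp only [Matrix.trace, Matrix.diag, Matrix.mul_apply]
      exact Finset.sum_congr rfl fun j _ => Finset.sum_congr rfl fun k _ => by rw [hhT]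
    rw [this, hhdef, ← Matrix.mul_assoc, Matrix.trace_mul_comm, ← Matrix.mul_assoc,
      ← Matrix.mul_assoc, hpr, Matrix.trace]
    exact Finset.sum_congr rfl fun a _ => by
      simp [hH, Matrix.mul_diagonal, Matrix.vecMulVec_apply]; ring
  have htr2 : ∑ j, ∑ k, (e * e.transpose)⁻¹ j k * ∑ i, ∑ m, (e * e.transpose)⁻¹ i m *
        (h i k * h j m)
      = ∑ a, ρ a ^ 2 * (1 - 2 * (n ⬝ᵥ n)⁻¹ * n a ^ 2)
          + (∑ a, ρ a * ((n ⬝ᵥ n)⁻¹ * n a ^ 2)) ^ 2 := by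
    have h1 : ∑ j, ∑ k, (e * e.transpose)⁻¹ j k * ∑ i, ∑ m, (e * e.transpose)⁻¹ i m *
        (h i k * h j m)
        = ((e * e.transpose)⁻¹ * h * ((e * e.transpose)⁻¹ * h)).trace := by
      simp only [Matrix.trace, Matrix.diag, Matrix.mul_apply, Finset.mul_sum, Finset.sum_mul]
      refine Finset.sum_congr rfl fun j _ => ?_
      rw [Finset.sum_comm]
      refine Finset.sum_congr rfl fun i _ => ?_
      rw [Finset.sum_comm]
      refine Finset.sum_congr rfl fun m _ => Finset.sum_congr rfl fun k _ => ?_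
      rw [hhT i k, hhT j m]
      ring
    -- Cyclicity of the trace moves the computation from the tangent coordinates to the ambient
    -- space, where the projection is explicit.
    have h2 : ((e * e.transpose)⁻¹ * h * ((e * e.transpose)⁻¹ * h)).trace
        = ((e.transpose * (e * e.transpose)⁻¹ * e) * H *
            ((e.transpose * (e * e.transpose)⁻¹ * e) * H)).trace := by
      rw [hhdef]
      have : (e * e.transpose)⁻¹ * (e * H * e.transpose) *
          ((e * e.transpose)⁻¹ * (e * H * e.transpose)) =
          ((e * e.transpose)⁻¹ * e * H * (e.transpose * (e * e.transpose)⁻¹ * e * H))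
            * e.transpose := by
        simp only [Matrix.mul_assoc]
      rw [this, Matrix.trace_mul_comm]
      simp only [Matrix.mul_assoc]
    rw [h1, h2, hpr]
    have h3 : ∀ a c, ((1 - (n ⬝ᵥ n)⁻¹ • Matrix.vecMulVec n n) * H) a c
        = ((if a = c then 1 else 0) - (n ⬝ᵥ n)⁻¹ * (n a * n c)) * ρ c := by
      intro a c
      simp [hH, Matrix.mul_diagonal, Matrix.vecMulVec_apply, Matrix.one_apply]
    simp only [Matrix.trace, Matrix.diag]
    rw [sq (∑ a, _), Finset.sum_mul_sum, ← Finset.sum_add_distrib]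
    refine Finset.sum_congr rfl fun a _ => ?_
    rw [Matrix.mul_apply]
    simp only [h3]
    -- The entry of the projection has a Kronecker delta only for `c = a`, so that term is separated
    -- from the others.
    rw [← Finset.add_sum_erase _ _ (Finset.mem_univ a),
      ← Finset.add_sum_erase _ (fun c => ρ a * _ * _) (Finset.mem_univ a), ← add_assoc]
    congr 1
    · simp; ring
    · refine Finset.sum_congr rfl fun c hc => ?_
      have hca : c ≠ a := Finset.ne_of_mem_erase hc
      simp [hca, hca.symm]; ring
  rw [← htr1, ← htr2, scalarCurvature]
  have hmt : metricTensor b g p = e * e.transpose := by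
    have := (metricTensor_affineChart hg).self_of_nhds
    rwa [affineChart_zero, hG] at this
  simp only [ricciTensor, riemannTensor_eq hy hg (hG ▸ hdet), hmt, hG, hnp]
  rw [sq, Finset.sum_mul, ← Finset.sum_sub_distrib, Finset.sum_div]
  refine Finset.sum_congr rfl fun j _ => ?_
  rw [Finset.sum_mul, ← Finset.sum_sub_distrib, Finset.sum_div]
  refine Finset.sum_congr rfl fun k _ => ?_
  rw [mul_assoc, ← mul_sub, mul_div_assoc]
  congr 1
  rw [Finset.mul_sum, ← Finset.sum_sub_distrib, Finset.sum_div]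
  refine Finset.sum_congr rfl fun i _ => ?_
  rw [Finset.mul_sum, ← Finset.sum_sub_distrib, Finset.sum_div]
  refine Finset.sum_congr rfl fun m _ => ?_
  rw [div_eq_mul_inv]
  ring

end Hypersurface

end

noncomputable section

/-! ### Algebra from traces to the sums in the curvature formulas. -/

section Formula

/-- Since `(1 - νᵢ)(1 - νₖ) - νᵢνₖ = 1 - νᵢ - νₖ`, the difference of the squares is a full double
sum, and the remaining sum is precisely its diagonal. -/
theorem sq_sum_sub_eq_sum_erase {n : ℕ} (a ν : Fin n → ℝ) :
    (∑ k, a k * (1 - ν k)) ^ 2 - (∑ k, a k ^ 2 * (1 - 2 * ν k) + (∑ k, a k * ν k) ^ 2)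
      = ∑ i, ∑ k ∈ Finset.univ.erase i, a i * a k * (1 - ν i - ν k) := by
  have h : ∀ i, ∑ k ∈ Finset.univ.erase i, a i * a k * (1 - ν i - ν k)
      = ∑ k, a i * a k * (1 - ν i - ν k) - a i * a i * (1 - ν i - ν i) := fun i => by
    rw [← Finset.add_sum_erase _ _ (Finset.mem_univ i)]
    ring
  simp only [h, Finset.sum_sub_distrib]
  rw [sq, sq (∑ k, a k * ν k), Finset.sum_mul_sum, Finset.sum_mul_sum, add_comm, ← sub_sub,
    ← Finset.sum_sub_distrib]
  congr 1
  · refine Finset.sum_congr rfl fun i _ => ?_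
    rw [← Finset.sum_sub_distrib]
    exact Finset.sum_congr rfl fun k _ => by ring
  · exact Finset.sum_congr rfl fun i _ => by ring

theorem cNorm_sq {n : ℕ} (f : ℝ → ℝ) (l : Fin n → ℝ) :
    cNorm f l ^ 2 = ∑ k, 1 / deriv f (l k) ^ 2 :=
  Real.sq_sqrt (Finset.sum_nonneg fun k _ => by positivity)

/-- `R` and `S` are the contributions of the off-diagonal directions. -/
theorem curvature_formula {n : ℕ} (f : ℝ → ℝ) (l : Fin n → ℝ) (hc : cNorm f l ^ 2 ≠ 0)
    (R S : ℝ) :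
    ((∑ k, -(deriv (deriv f) (l k) / deriv f (l k) ^ 3) *
          (1 - (cNorm f l ^ 2)⁻¹ * (deriv f (l k))⁻¹ ^ 2) + R) ^ 2
        - (∑ k, (-(deriv (deriv f) (l k) / deriv f (l k) ^ 3)) ^ 2 *
            (1 - 2 * (cNorm f l ^ 2)⁻¹ * (deriv f (l k))⁻¹ ^ 2) + S
          + (∑ k, -(deriv (deriv f) (l k) / deriv f (l k) ^ 3) *
            ((cNorm f l ^ 2)⁻¹ * (deriv f (l k))⁻¹ ^ 2)) ^ 2)) / cNorm f l ^ 2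
      = 4 / cNorm f l ^ 4 * (diagDoubleSum f l - diagSum f l * R)
        + R ^ 2 / cNorm f l ^ 2 - S / cNorm f l ^ 2 := by
  have hc' : cNorm f l ≠ 0 := fun h => hc (by simp [h])
  have h1 := sq_sum_sub_eq_sum_erase (fun k => -(deriv (deriv f) (l k) / deriv f (l k) ^ 3))
    (fun k => (cNorm f l ^ 2)⁻¹ * (deriv f (l k))⁻¹ ^ 2)
  have h2 : ∑ k, -(deriv (deriv f) (l k) / deriv f (l k) ^ 3) *
          (1 - (cNorm f l ^ 2)⁻¹ * (deriv f (l k))⁻¹ ^ 2)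
      = -2 / cNorm f l ^ 2 * diagSum f l := by
    rw [diagSum, Finset.mul_sum]
    refine Finset.sum_congr rfl fun k _ => ?_
    rw [M₃, M₂, inv_pow, one_div, div_right_comm]
    generalize (deriv f (l k) ^ 2)⁻¹ = u
    generalize deriv (deriv f) (l k) / deriv f (l k) ^ 3 = v
    field_simp
  have h3 : ∑ i, ∑ k ∈ Finset.univ.erase i, -(deriv (deriv f) (l i) / deriv f (l i) ^ 3) *
      -(deriv (deriv f) (l k) / deriv f (l k) ^ 3) *
        (1 - (cNorm f l ^ 2)⁻¹ * (deriv f (l i))⁻¹ ^ 2 - (cNorm f l ^ 2)⁻¹ *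
          (deriv f (l k))⁻¹ ^ 2) = 4 / cNorm f l ^ 2 * diagDoubleSum f l := by
    rw [diagDoubleSum, Finset.mul_sum]
    refine Finset.sum_congr rfl fun i _ => ?_
    rw [Finset.mul_sum]
    refine Finset.sum_congr rfl fun k _ => ?_
    simp only [M₃, M₂, inv_pow]
    rw [one_div, one_div]
    generalize (deriv f (l i) ^ 2)⁻¹ = u
    generalize (deriv f (l k) ^ 2)⁻¹ = v
    rw [mul_comm (deriv f (l i) ^ 3), ← div_div]
    field_simp
    ring
  rw [h3] at h1
  simp only [mul_assoc] at h1 ⊢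
  set α := ∑ k, -(deriv (deriv f) (l k) / deriv f (l k) ^ 3) *
    (1 - (cNorm f l ^ 2)⁻¹ * (deriv f (l k))⁻¹ ^ 2)
  set β := ∑ k, (-(deriv (deriv f) (l k) / deriv f (l k) ^ 3)) ^ 2 *
    (1 - 2 * ((cNorm f l ^ 2)⁻¹ * (deriv f (l k))⁻¹ ^ 2))
  set γ := ∑ k, -(deriv (deriv f) (l k) / deriv f (l k) ^ 3) *
    ((cNorm f l ^ 2)⁻¹ * (deriv f (l k))⁻¹ ^ 2)
  have h4 : (α + R) ^ 2 - (β + S + γ ^ 2)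
      = 4 / cNorm f l ^ 2 * diagDoubleSum f l + 2 * α * R + R ^ 2 - S := by
    rw [← h1]; ring
  rw [h4, h2, show cNorm f l ^ 4 = cNorm f l ^ 2 * cNorm f l ^ 2 by ring]
  field_simp
  ring

end Formula

/-! ### Immersions that apply `f` to each coordinate. -/

section Coordinatewise

theorem ContDiffAt.deriv_of_add_one_le {f : ℝ → ℝ} {x : ℝ} {m n : WithTop ℕ∞}
    (hf : ContDiffAt ℝ n f x) (hmn : m + 1 ≤ n) : ContDiffAt ℝ m (deriv f) x :=
  (hf.fderiv_right hmn).clm_apply (contDiffAt_const (c := (1 : ℝ)))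

variable {E : Type*} [AddCommGroup E] [Module ℝ E] {T : Submodule ℝ E} {d : ℕ}
  {b : Module.Basis (Fin d) ℝ T} {g : E → E → E → ℝ} {p : E}

variable (b) in
theorem exists_eq_sum_smul_basis {X : E} (hX : X ∈ T) :
    ∃ a : Fin d → ℝ, X = ∑ i, a i • (b i : E) := by
  refine ⟨b.repr ⟨X, hX⟩, ?_⟩
  refine (congrArg Subtype.val (b.sum_repr ⟨X, hX⟩)).symm.trans ?_
  rw [Submodule.coe_sum]
  rfl

theorem hasFDerivAt_comp_affineChart (ℓ : E →ₗ[ℝ] ℝ) (x : Fin d → ℝ) :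
    ∃ L : (Fin d → ℝ) →L[ℝ] ℝ, HasFDerivAt (fun x => ℓ (affineChart b p x)) L x ∧
      ∀ i, L (Pi.single i 1) = ℓ (b i) := by
  refine ⟨∑ i, ℓ (b i) • ContinuousLinearMap.proj (R := ℝ) (φ := fun _ : Fin d => ℝ) i, ?_, ?_⟩
  · have h : (fun x => ℓ (affineChart b p x)) = fun x => ℓ p +
        (∑ i, ℓ (b i) • ContinuousLinearMap.proj (R := ℝ) (φ := fun _ : Fin d => ℝ) i) x := by
      funext x
      simp [affineChart, mul_comm]
    rw [h]
    exact (ContinuousLinearMap.hasFDerivAt _).const_add _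
  · intro i
    simp [Pi.single_apply]

theorem contDiff_comp_affineChart (ℓ : E →ₗ[ℝ] ℝ) {N : WithTop ℕ∞} :
    ContDiff ℝ N fun x : Fin d → ℝ => ℓ (affineChart b p x) := by
  simp only [affineChart, map_add, map_sum, map_smul, smul_eq_mul]
  fun_prop

theorem pderiv_comp_affineChart {f : ℝ → ℝ} {ℓ : E →ₗ[ℝ] ℝ} {x : Fin d → ℝ}
    (hf : DifferentiableAt ℝ f (ℓ (affineChart b p x))) (i : Fin d) :
    pderiv i (fun x => f (ℓ (affineChart b p x))) x
      = deriv f (ℓ (affineChart b p x)) * ℓ (b i) := by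
  obtain ⟨L, hL, hLi⟩ := hasFDerivAt_comp_affineChart (b := b) (p := p) ℓ x
  have := (hf.hasDerivAt.comp_hasFDerivAt x hL).fderiv
  rw [pderiv]
  simp only [Function.comp_def] at this
  rw [this, _root_.smul_apply, hLi, smul_eq_mul]

theorem pderiv_pi_apply {ι : Type*} [Fintype ι] {y : (Fin d → ℝ) → ι → ℝ} {x : Fin d → ℝ}
    (hy : DifferentiableAt ℝ y x) (i : Fin d) (a : ι) :
    pderiv i y x a = pderiv i (fun z => y z a) x := by
  have := (hasFDerivAt_pi'.1 hy.hasFDerivAt a).fderiv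
  rw [pderiv, pderiv, this]
  rfl

/-- The scalar curvature of the pull-back of the canonical metric of `ℝⁿ` along
`q ↦ (f (ℓ₁ q), …, f (ℓₙ q))`, where the linear forms `ℓₖ` identify the tangent space with the
vectors of sum zero. -/
theorem scalarCurvature_coordinatewise {n : ℕ} [NeZero n] {f : ℝ → ℝ} (ℓ : Fin n → E →ₗ[ℝ] ℝ)
    (hf : ∀ k, ContDiffAt ℝ 3 f (ℓ k p)) (hf' : ∀ k, deriv f (ℓ k p) ≠ 0)
    (hsum : ∀ X ∈ T, ∑ k, ℓ k X = 0) (hinj : ∀ X ∈ T, (∀ k, ℓ k X = 0) → X = 0)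
    (hsurj : ∀ v : Fin n → ℝ, ∑ k, v k = 0 → ∃ X ∈ T, ∀ k, ℓ k X = v k)
    (hg : ∀ᶠ x in 𝓝 0, ∀ i j, g (affineChart b p x) (b i) (b j) = ∑ k,
      (deriv f (ℓ k (affineChart b p x)) * ℓ k (b i)) *
        (deriv f (ℓ k (affineChart b p x)) * ℓ k (b j))) :
    scalarCurvature b g p
      = 4 / cNorm f (fun k => ℓ k p) ^ 4 * diagDoubleSum f (fun k => ℓ k p) := by
  set l : Fin n → ℝ := fun k => ℓ k p with hl
  set y : (Fin d → ℝ) → Fin n → ℝ := fun x k => f (ℓ k (affineChart b p x)) with hy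
  -- The factors `1/f'` cancel the `f'` in `∂ᵢy`, so orthogonality becomes the condition that
  -- tangent vectors have coordinate sum zero.
  set N : (Fin d → ℝ) → Fin n → ℝ := fun x k => (deriv f (ℓ k (affineChart b p x)))⁻¹ with hN
  have hy3 : ContDiffAt ℝ 3 y 0 := contDiffAt_pi.2 fun k =>
    ContDiffAt.comp (g := f) (0 : Fin d → ℝ) (by simpa using hf k)
      (contDiff_comp_affineChart (ℓ k)).contDiffAt
  have hfx : ∀ᶠ x in 𝓝 (0 : Fin d → ℝ), ∀ k, ContDiffAt ℝ 3 f (ℓ k (affineChart b p x)) ∧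
      deriv f (ℓ k (affineChart b p x)) ≠ 0 := by
    refine eventually_all.2 fun k => ?_
    have ht : Tendsto (fun x : Fin d → ℝ => ℓ k (affineChart b p x)) (𝓝 0) (𝓝 (ℓ k p)) := by
      simpa using (contDiff_comp_affineChart (b := b) (p := p) (N := 0) (ℓ k)).continuous.tendsto 0
    exact ht.eventually (((hf k).eventually (by simp)).and
      (((hf k).deriv_of_add_one_le (m := 2) (by norm_num)).continuousAt.eventually_ne (hf' k)))
  have hpy : ∀ᶠ x in 𝓝 (0 : Fin d → ℝ), ∀ i k,
      pderiv i y x k = deriv f (ℓ k (affineChart b p x)) * ℓ k (b i) := by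
    filter_upwards [hfx, hy3.eventually (by simp)] with x hx hyx i k
    rw [pderiv_pi_apply (hyx.differentiableAt (by norm_num)),
      pderiv_comp_affineChart ((hx k).1.differentiableAt (by norm_num))]
  have hpy0 : ∀ i k, pderiv i y 0 k = deriv f (l k) * ℓ k (b i) := by
    simpa using hpy.self_of_nhds
  have hd2 : ∀ k, DifferentiableAt ℝ (deriv f) (ℓ k p) := fun k =>
    ((hf k).deriv_of_add_one_le (m := 2) (by norm_num)).differentiableAt (by norm_num)
  have hNd : DifferentiableAt ℝ N 0 := by
    refine differentiableAt_pi.2 fun k => ?_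
    refine DifferentiableAt.comp (g := fun t => (deriv f t)⁻¹) (0 : Fin d → ℝ) ?_
      ((contDiff_comp_affineChart (N := 1) (ℓ k)).differentiable (by norm_num) 0)
    rw [affineChart_zero]
    exact (hd2 k).inv (hf' k)
  have hN0 : ∀ k, N 0 k = (deriv f (l k))⁻¹ := fun k => by simp [hN, hl]
  have hc : N 0 ⬝ᵥ N 0 = cNorm f l ^ 2 := by
    rw [cNorm_sq, dotProduct]
    exact Finset.sum_congr rfl fun k _ => by rw [hN0, one_div, ← mul_inv, sq]
  have hc0 : cNorm f l ^ 2 ≠ 0 := by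
    rw [cNorm_sq]
    refine (Finset.sum_pos (fun k _ => ?_) Finset.univ_nonempty).ne'
    have := hf' k
    positivity
  have main := scalarCurvature_hypersurface (b := b) (g := g) (y := y) (N := N) (p := p)
    (ρ := fun k => -(deriv (deriv f) (l k) / deriv f (l k) ^ 3)) hy3
    (by
      filter_upwards [hg, hpy] with x hx hx' i j
      rw [hx, dotProduct]
      simp only [hx'])
    (by
      rw [Fintype.linearIndependent_iff]
      intro a ha
      have hz : (∑ i, a i • (b i : E)) = 0 := by
        refine hinj _ (Submodule.sum_mem _ fun i _ => T.smul_mem _ (b i).2) fun k => ?_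
        have h1 := congrFun ha k
        simp only [Finset.sum_apply, Pi.smul_apply, smul_eq_mul, hpy0, Pi.zero_apply] at h1
        refine mul_left_cancel₀ (hf' k) ?_
        rw [mul_zero, ← h1]
        simp only [map_sum, map_smul, smul_eq_mul, Finset.mul_sum]
        exact Finset.sum_congr rfl fun i _ => by simp only [hl]; ring
      have hz' : ∑ i, a i • b i = 0 := Subtype.ext (by simpa using hz)
      exact Fintype.linearIndependent_iff.1 b.linearIndependent a hz')
    hNd
    (by
      filter_upwards [hpy, hfx] with x hx hx' i
      rw [← hsum _ (b i).2, dotProduct]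
      refine Finset.sum_congr rfl fun k _ => ?_
      rw [hx]
      have := (hx' k).2
      simp only [hN]
      field_simp)
    (hc ▸ hc0)
    (by
      intro v hv
      have hT0 : ∀ X ∈ T, ∑ k, deriv f (l k) * v k * ℓ k X = 0 := by
        intro X hX
        obtain ⟨a, rfl⟩ := exists_eq_sum_smul_basis b hX
        have h1 : ∑ i, a i * (pderiv i y 0 ⬝ᵥ v) = 0 := by simp [hv]
        rw [← h1]
        simp only [map_sum, map_smul, smul_eq_mul, Finset.mul_sum, dotProduct, hpy0]
        rw [Finset.sum_comm]
        exact Finset.sum_congr rfl fun i _ => Finset.sum_congr rfl fun k _ => by ring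
      -- Testing against the tangent vector with coordinates `eₖ - e₀` shows that `f'(lₖ) vₖ` does
      -- not depend on `k`; this common value is the factor.
      refine ⟨deriv f (l 0) * v 0, funext fun k => ?_⟩
      have hk : deriv f (l k) * v k = deriv f (l 0) * v 0 := by
        obtain ⟨X, hX, hXk⟩ := hsurj (Pi.single k 1 - Pi.single 0 1) (by
          simp [Finset.sum_sub_distrib])
        have := hT0 X hX
        simp only [hXk, Pi.sub_apply, mul_sub, Finset.sum_sub_distrib, Pi.single_apply,
          mul_ite, mul_one, mul_zero, Finset.sum_ite_eq', Finset.mem_univ, if_true] at this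
        linarith
      rw [Pi.smul_apply, hN0, smul_eq_mul, ← hk, mul_comm (deriv f (l k)),
        mul_inv_cancel_right₀ (hf' k)])
    (by
      intro i k
      rw [pderiv_pi_apply hNd, pderiv_comp_affineChart (f := fun t => (deriv f t)⁻¹)
        (by rw [affineChart_zero]; exact (hd2 k).inv (hf' k)), affineChart_zero,
        deriv_fun_inv'' (hd2 k) (hf' k), hpy0]
      have := hf' k
      simp only [hl]
      field_simp)
  rw [main, hc]
  simp only [hN0]
  have := curvature_formula f l hc0 0 0
  simp only [add_zero, mul_zero, sub_zero, zero_div, ne_eq, OfNat.ofNat_ne_zero,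
    not_false_eq_true, zero_pow] at this
  exact this

end Coordinatewise

end

noncomputable section

/-! ### The classical `α`-geometry. -/

section Alpha

/-- The normalisation `2/(1-α)` makes the derivative the same power law in both branches, so `α = 1`
needs no separate treatment afterwards. -/
theorem alphaFun_hasDerivAt (α : ℝ) {x : ℝ} (hx : 0 < x) :
    HasDerivAt (alphaFun α) (x ^ (-(1 + α) / 2)) x := by
  by_cases hα : α = 1
  · have h : alphaFun α = Real.log := by funext t; simp [alphaFun, hα]
    rw [h]
    convert Real.hasDerivAt_log hx.ne' using 1
    rw [hα, show (-(1 + 1) / 2 : ℝ) = -1 by norm_num, Real.rpow_neg_one]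
  · have h : alphaFun α = fun t => 2 / (1 - α) * t ^ ((1 - α) / 2) := by
      funext t; simp [alphaFun, hα]
    have h1 : 1 - α ≠ 0 := sub_ne_zero.2 (Ne.symm hα)
    rw [h]
    refine ((Real.hasDerivAt_rpow_const (p := (1 - α) / 2) (Or.inl hx.ne')).const_mul
      (2 / (1 - α))).congr_deriv ?_
    rw [show (1 - α) / 2 - 1 = -(1 + α) / 2 by ring]
    field_simp

theorem deriv_alphaFun (α : ℝ) {x : ℝ} (hx : 0 < x) :
    deriv (alphaFun α) x = x ^ (-(1 + α) / 2) :=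
  (alphaFun_hasDerivAt α hx).deriv

theorem deriv_deriv_alphaFun (α : ℝ) {x : ℝ} (hx : 0 < x) :
    deriv (deriv (alphaFun α)) x = -(1 + α) / 2 * x ^ (-(1 + α) / 2 - 1) := by
  have h : deriv (alphaFun α) =ᶠ[𝓝 x] fun t => t ^ (-(1 + α) / 2) := by
    filter_upwards [lt_mem_nhds hx] with t ht using deriv_alphaFun α ht
  rw [h.deriv_eq]
  exact (Real.hasDerivAt_rpow_const (Or.inl hx.ne')).deriv

theorem contDiffAt_alphaFun (α : ℝ) {x : ℝ} (hx : 0 < x) {N : WithTop ℕ∞} :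
    ContDiffAt ℝ N (alphaFun α) x := by
  by_cases hα : α = 1
  · have h : alphaFun α = Real.log := by funext t; simp [alphaFun, hα]
    rw [h]
    exact Real.contDiffAt_log.2 hx.ne'
  · have h : alphaFun α = fun t => 2 / (1 - α) * t ^ ((1 - α) / 2) := by
      funext t; simp [alphaFun, hα]
    rw [h]
    exact contDiffAt_const.mul (Real.contDiffAt_rpow_const_of_ne hx.ne')

theorem gAlpha_eq {n : ℕ} (α : ℝ) {θ : Fin n → ℝ} (hθ : ∀ k, 0 < θ k) (X Y : Fin n → ℝ) :
    gAlpha α θ X Y = ∑ k, (deriv (alphaFun α) (θ k) * X k) * (deriv (alphaFun α) (θ k) * Y k) := by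
  have h : ∀ Z : Fin n → ℝ, dirDeriv (fun (η : Fin n → ℝ) (i : Fin n) => alphaFun α (η i)) θ Z
      = fun k => deriv (alphaFun α) (θ k) * Z k := by
    intro Z
    refine (hasDerivAt_pi.2 fun k => ?_).deriv
    have h1 : HasDerivAt (fun t : ℝ => (θ + t • Z) k) (Z k) 0 := by
      simpa using ((hasDerivAt_id (0 : ℝ)).mul_const (Z k)).const_add (θ k)
    have h2 : HasDerivAt (alphaFun α) (deriv (alphaFun α) (θ k)) ((θ + (0 : ℝ) • Z) k) := by
      simpa using (alphaFun_hasDerivAt α (hθ k)).differentiableAt.hasDerivAt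
    exact h2.comp (0 : ℝ) h1
  simp only [gAlpha, pullbackMetric, h]

theorem cNorm_alphaFun {n : ℕ} (α : ℝ) {θ : Fin n → ℝ} (hθ : ∀ k, 0 < θ k) :
    cNorm (alphaFun α) θ = √(∑ k, θ k ^ (α + 1)) := by
  rw [cNorm]
  congr 1
  refine Finset.sum_congr rfl fun k _ => ?_
  rw [deriv_alphaFun α (hθ k), one_div, ← Real.rpow_natCast, ← Real.rpow_mul (hθ k).le,
    ← Real.rpow_neg (hθ k).le]
  congr 1
  push_cast
  ring

theorem scalarCurvature_gAlpha {n : ℕ} (α : ℝ) {θ : Fin n → ℝ} (hθ : θ ∈ probSpace n) {d : ℕ}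
    (b : Module.Basis (Fin d) ℝ (probTangent n)) {c : ℝ} (hc : c = √(∑ k, θ k ^ (α + 1))) :
    scalarCurvature b (gAlpha α) θ =
      (1 + α) ^ 2 / (4 * c ^ 2) * ∑ t, ∑ s ∈ Finset.univ.erase t,
        θ t ^ α * θ s ^ α * (1 - (θ t ^ (α + 1) + θ s ^ (α + 1)) / c ^ 2) := by
  obtain ⟨hpos, hsum⟩ := hθ
  have hn : n ≠ 0 := by
    rintro rfl
    simp at hsum
  have : NeZero n := ⟨hn⟩
  have hc0 : c ^ 2 ≠ 0 := by
    rw [hc, Real.sq_sqrt (Finset.sum_nonneg fun k _ => Real.rpow_nonneg (hpos k).le _)]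
    exact (Finset.sum_pos (fun k _ => Real.rpow_pos_of_pos (hpos k) _) Finset.univ_nonempty).ne'
  rw [scalarCurvature_coordinatewise (f := alphaFun α) (fun k => LinearMap.proj k)
    (fun k => contDiffAt_alphaFun α (hpos k))
    (fun k => by
      rw [LinearMap.proj_apply, deriv_alphaFun α (hpos k)]
      exact (Real.rpow_pos_of_pos (hpos k) _).ne')
    -- The case `n = 1` is not split off here: `alphaFun` is smooth at every positive argument,
    -- including `1`.
    (fun X hX => hX) (fun X _ h => funext h) (fun v hv => ⟨v, hv, fun k => rfl⟩) ?_]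
  · simp only [LinearMap.proj_apply]
    rw [cNorm_alphaFun α hpos, ← hc, diagDoubleSum, Finset.mul_sum, Finset.mul_sum]
    refine Finset.sum_congr rfl fun i _ => ?_
    rw [Finset.mul_sum, Finset.mul_sum]
    refine Finset.sum_congr rfl fun k _ => ?_
    have h1 : ∀ k, 1 / M₂ (alphaFun α) (θ k) ^ 2 = θ k ^ (α + 1) := by
      intro k
      rw [M₂, deriv_alphaFun α (hpos k), one_div, ← Real.rpow_natCast,
        ← Real.rpow_mul (hpos k).le, ← Real.rpow_neg (hpos k).le]
      congr 1
      push_cast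
      ring
    have h2 : ∀ k, M₃ (alphaFun α) (θ k) / M₂ (alphaFun α) (θ k) ^ 3
        = -(1 + α) / 4 * θ k ^ α := by
      intro k
      rw [M₂, M₃, deriv_alphaFun α (hpos k), deriv_deriv_alphaFun α (hpos k),
        ← Real.rpow_natCast, ← Real.rpow_mul (hpos k).le, mul_div_right_comm, mul_div_assoc,
        ← Real.rpow_sub (hpos k)]
      rw [show -(1 + α) / 2 - 1 - -(1 + α) / 2 * ((3 : ℕ) : ℝ) = α by push_cast; ring]
      ring
    rw [mul_div_mul_comm, h1, h1, h2, h2, cNorm_alphaFun α hpos, ← hc]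
    have hc1 : c ≠ 0 := fun h => hc0 (by simp [h])
    field_simp
    ring
  · have hev : ∀ᶠ x in 𝓝 (0 : Fin d → ℝ), ∀ k, 0 < affineChart b θ x k := by
      refine eventually_all.2 fun k => ?_
      have ht := (contDiff_comp_affineChart (b := b) (p := θ) (N := 0)
        (LinearMap.proj k)).continuous.tendsto 0
      simp only [affineChart_zero, LinearMap.proj_apply] at ht
      exact ht.eventually (lt_mem_nhds (hpos k))
    filter_upwards [hev] with x hx i j
    exact gAlpha_eq α hx _ _

end Alpha

end

noncomputable section

/-! ### Smooth dependence of integrals on parameters. -/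

section ParametricIntegral

open Set MeasureTheory

variable {X G : Type} [NormedAddCommGroup X] [NormedAddCommGroup G] {O : Set X}

/-- Compactness of the interval gives one bound valid near `x₀`, which serves as the dominating
constant for differentiation under the integral. -/
theorem eventually_forall_norm_le_of_continuousOn (hO : IsOpen O) {Ψ : X × ℝ → G}
    (hΨ : ContinuousOn Ψ (O ×ˢ univ)) (a b : ℝ) {x₀ : X} (hx₀ : x₀ ∈ O) :
    ∃ C, ∀ᶠ x in 𝓝 x₀, ∀ t ∈ uIcc a b, ‖Ψ (x, t)‖ ≤ C := by
  have hat : ∀ t, ContinuousAt Ψ (x₀, t) := fun t =>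
    hΨ.continuousAt ((hO.prod isOpen_univ).mem_nhds ⟨hx₀, mem_univ t⟩)
  have hc : Continuous fun t => Ψ (x₀, t) := continuous_iff_continuousAt.2 fun t =>
    ContinuousAt.comp (f := fun t => (x₀, t)) (hat t) (by fun_prop)
  obtain ⟨C, hC⟩ := isCompact_uIcc.exists_bound_of_continuousOn (s := uIcc a b) hc.continuousOn
  refine ⟨C + 1, isCompact_uIcc.eventually_forall_of_forall_eventually fun t ht => ?_⟩
  exact ((hat t).norm.eventually_lt continuousAt_const
    ((hC t ht).trans_lt (lt_add_one C))).mono fun _ => le_of_lt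

theorem continuous_slice_of_continuousOn {Ψ : X × ℝ → G} (hO : IsOpen O)
    (hΨ : ContinuousOn Ψ (O ×ˢ univ)) {x : X} (hx : x ∈ O) : Continuous fun t => Ψ (x, t) :=
  continuous_iff_continuousAt.2 fun t => ContinuousAt.comp (f := fun t => (x, t))
    (hΨ.continuousAt ((hO.prod isOpen_univ).mem_nhds ⟨hx, mem_univ t⟩)) (by fun_prop)

variable [NormedSpace ℝ X] [NormedSpace ℝ G]

/-- An integral over a compact interval depends smoothly on parameters. -/
theorem contDiffOn_parametric_intervalIntegral [CompleteSpace G] (hO : IsOpen O) (N : ℕ)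
    {Ψ : X × ℝ → G} (hΨ : ContDiffOn ℝ N Ψ (O ×ˢ univ)) (a b : ℝ) :
    ContDiffOn ℝ N (fun x => ∫ t in a..b, Ψ (x, t)) O := by
  -- The derivative of the integral is an integral with values in `X →L[ℝ] G`, so the target space
  -- changes in the induction.
  induction N generalizing G with
  | zero =>
    have hc := hΨ.continuousOn
    refine contDiffOn_zero.2 fun x₀ hx₀ => ContinuousAt.continuousWithinAt ?_
    obtain ⟨C, hC⟩ := eventually_forall_norm_le_of_continuousOn hO hc a b hx₀
    refine intervalIntegral.continuousAt_of_dominated_interval (bound := fun _ => C) ?_ ?_ ?_ ?_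
    · filter_upwards [hO.mem_nhds hx₀] with x hx
      exact (continuous_slice_of_continuousOn hO hc hx).aestronglyMeasurable
    · filter_upwards [hC] with x hx
      exact .of_forall fun t ht => hx t (uIoc_subset_uIcc ht)
    · exact intervalIntegrable_const
    · exact .of_forall fun t _ => ContinuousAt.comp (f := fun x => (x, t))
        (hc.continuousAt ((hO.prod isOpen_univ).mem_nhds ⟨hx₀, mem_univ t⟩)) (by fun_prop)
  | succ N ih =>
    have hOU : IsOpen (O ×ˢ (univ : Set ℝ)) := hO.prod isOpen_univ
    have hc := hΨ.continuousOn
    push_cast at hΨ ⊢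
    rw [contDiffOn_succ_iff_fderiv_of_isOpen hOU] at hΨ
    obtain ⟨hd, -, hf⟩ := hΨ
    set Ψ' : X × ℝ → X →L[ℝ] G := fun z => (fderiv ℝ Ψ z).comp (ContinuousLinearMap.inl ℝ X ℝ)
      with hΨ'
    have hΨ'c : ContDiffOn ℝ N Ψ' (O ×ˢ univ) := hf.clm_comp contDiffOn_const
    have hder : ∀ x ∈ O, HasFDerivAt (fun x => ∫ t in a..b, Ψ (x, t))
        (∫ t in a..b, Ψ' (x, t)) x := by
      intro x₀ hx₀
      obtain ⟨C, hC⟩ := eventually_forall_norm_le_of_continuousOn hO hΨ'c.continuousOn a b hx₀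
      refine intervalIntegral.hasFDerivAt_integral_of_dominated_of_fderiv_le
        (F' := fun x t => Ψ' (x, t)) (bound := fun _ => C)
        (inter_mem (hO.mem_nhds hx₀) hC) ?_ ?_ ?_ ?_ ?_ ?_
      · filter_upwards [hO.mem_nhds hx₀] with x hx
        exact (continuous_slice_of_continuousOn hO hc hx).aestronglyMeasurable
      · exact (continuous_slice_of_continuousOn hO hc hx₀).intervalIntegrable _ _
      · exact (continuous_slice_of_continuousOn hO hΨ'c.continuousOn hx₀).aestronglyMeasurable
      · exact .of_forall fun t ht x hx => hx.2 t (uIoc_subset_uIcc ht)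
      · exact intervalIntegrable_const
      · refine .of_forall fun t _ x hx => ?_
        have h1 : HasFDerivAt Ψ (fderiv ℝ Ψ (x, t)) (x, t) :=
          (hd.differentiableAt (hOU.mem_nhds ⟨hx.1, mem_univ t⟩)).hasFDerivAt
        exact h1.comp x (hasFDerivAt_prodMk_left x t)
    rw [contDiffOn_succ_iff_fderiv_of_isOpen hO]
    refine ⟨fun x hx => (hder x hx).differentiableAt.differentiableWithinAt, by simp, ?_⟩
    exact (ih hΨ'c).congr fun x hx => (hder x hx).fderiv

end ParametricIntegral

/-! ### Stability of eigenvalues. -/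

section HermitianSpectrum

variable {𝕜 : Type*} [RCLike 𝕜] {n : ℕ}

open scoped Matrix.Norms.L2Operator in
/-- The eigenvalues of a Hermitian matrix depend upper semicontinuously on the matrix. -/
theorem eventually_eigenvalues_mem {X : Type*} [TopologicalSpace X]
    {A : X → Matrix (Fin n) (Fin n) 𝕜} {x₀ : X} (hA : ContinuousAt A x₀)
    (hH : ∀ x, (A x).IsHermitian) {V : Set ℝ} (hV : IsOpen V)
    (h0 : ∀ i, (hH x₀).eigenvalues i ∈ V) :
    ∀ᶠ x in 𝓝 x₀, ∀ i, (hH x).eigenvalues i ∈ V := by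
  have h1 := upperHemicontinuousAt_iff.1
    (upperHemicontinuous_iff.1 (upperHemicontinuous_spectrum 𝕜 (Matrix (Fin n) (Fin n) 𝕜)) (A x₀))
  have hO : IsOpen ((RCLike.re : 𝕜 → ℝ) ⁻¹' V) := hV.preimage RCLike.continuous_re
  have h2 := h1 (RCLike.re ⁻¹' V) (hO.mem_nhdsSet.2 (by
    rw [(hH x₀).spectrum_eq_image_range]
    rintro _ ⟨_, ⟨i, rfl⟩, rfl⟩
    simpa using h0 i))
  filter_upwards [hA.eventually h2] with x hx i
  have h3 : ((hH x).eigenvalues i : 𝕜) ∈ spectrum 𝕜 (A x) := by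
    rw [(hH x).spectrum_eq_image_range]
    exact ⟨_, ⟨i, rfl⟩, rfl⟩
  simpa using hO.mem_nhdsSet.1 hx h3

theorem det_smul_one_sub {A : Matrix (Fin n) (Fin n) 𝕜} (hA : A.IsHermitian) (z : 𝕜) :
    (z • (1 : Matrix (Fin n) (Fin n) 𝕜) - A).det = ∏ i, (z - hA.eigenvalues i) := by
  have h := Matrix.eval_charpoly A z
  rw [hA.charpoly_eq, Polynomial.eval_prod] at h
  rw [Matrix.smul_one_eq_diagonal, ← Matrix.scalar_apply, ← h]
  simp

end HermitianSpectrum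
end

noncomputable section

/-! ### Smoothness of `f(A)` by Cauchy integrals. -/

section SmoothFunctionalCalculus

open Set Metric

/-- `f` has a holomorphic extension to a neighbourhood of `]0,1[`. -/
def HasHolomorphicExtension (f : ℝ → ℝ) : Prop :=
  ∃ (U : Set ℂ) (F : ℂ → ℂ), IsOpen U ∧ (∀ x ∈ Ioo (0 : ℝ) 1, (x : ℂ) ∈ U) ∧
    DifferentiableOn ℂ F U ∧ ∀ x ∈ Ioo (0 : ℝ) 1, F (x : ℂ) = (f x : ℂ)

theorem HasHolomorphicExtension.contDiffAt {f : ℝ → ℝ} (hf : HasHolomorphicExtension f) {x : ℝ}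
    (hx : x ∈ Ioo (0 : ℝ) 1) {N : WithTop ℕ∞} : ContDiffAt ℝ N f x := by
  obtain ⟨U, F, hU, hxU, hF, hFf⟩ := hf
  have h1 : ContDiffAt ℂ N F x := (hF.analyticAt (hU.mem_nhds (hxU x hx))).contDiffAt
  refine h1.real_of_complex.congr_of_eventuallyEq ?_
  filter_upwards [isOpen_Ioo.mem_nhds hx] with t ht
  rw [hFf t ht, Complex.ofReal_re]

theorem deriv_eq_of_eqOn_real {f : ℝ → ℝ} {F : ℂ → ℂ} (hFf : ∀ x ∈ Ioo (0 : ℝ) 1, F x = f x)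
    {x : ℝ} (hx : x ∈ Ioo (0 : ℝ) 1) (hF : DifferentiableAt ℂ F x) (hf : DifferentiableAt ℝ f x) :
    deriv F x = (deriv f x : ℝ) := by
  have h1 : HasDerivAt (fun t : ℝ => F t) (deriv F x) x := hF.hasDerivAt.comp_ofReal
  have h2 : HasDerivAt (fun t : ℝ => (f t : ℂ)) ((deriv f x : ℝ) : ℂ) x := hf.hasDerivAt.ofReal_comp
  refine h1.unique (h2.congr_of_eventuallyEq ?_)
  filter_upwards [isOpen_Ioo.mem_nhds hx] with t ht using hFf t ht

/-- The singularity at `c` is removable. Closure under divided differences makes `dslope f c` of a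
matrix depend smoothly on the matrix as well, which yields the derivative of `f(A)`. -/
theorem HasHolomorphicExtension.dslope {f : ℝ → ℝ} (hf : HasHolomorphicExtension f) {c : ℝ}
    (hc : c ∈ Ioo (0 : ℝ) 1) : HasHolomorphicExtension (dslope f c) := by
  have hfd : DifferentiableAt ℝ f c := (hf.contDiffAt (N := 1) hc).differentiableAt (by norm_num)
  obtain ⟨U, F, hU, hxU, hF, hFf⟩ := hf
  have hcU := hU.mem_nhds (hxU c hc)
  refine ⟨U, _root_.dslope F c, hU, hxU, (Complex.differentiableOn_dslope hcU).2 hF,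
    fun x hx => ?_⟩
  by_cases h : x = c
  · subst h
    rw [dslope_same, dslope_same]
    exact deriv_eq_of_eqOn_real hFf hx (hF.differentiableAt hcU) hfd
  · rw [dslope_of_ne _ h, dslope_of_ne _ (by exact_mod_cast h), slope_def_field, slope_def_field,
      hFf x hx, hFf c hc]
    push_cast
    rfl

/-- On the interval the complex derivative is the real one and nonzero, so `U` only has to be shrunk
to the set where `F' ≠ 0`. This makes the normal field smooth. -/
theorem HasHolomorphicExtension.inv_deriv {f : ℝ → ℝ} (hf : HasHolomorphicExtension f)
    (hf' : ∀ x ∈ Ioo (0 : ℝ) 1, deriv f x ≠ 0) :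
    HasHolomorphicExtension fun x => (deriv f x)⁻¹ := by
  have hfd : ∀ x ∈ Ioo (0 : ℝ) 1, DifferentiableAt ℝ f x := fun x hx =>
    (hf.contDiffAt (N := 1) hx).differentiableAt (by norm_num)
  obtain ⟨U, F, hU, hxU, hF, hFf⟩ := hf
  have hd : ∀ x ∈ Ioo (0 : ℝ) 1, deriv F x = (deriv f x : ℝ) := fun x hx =>
    deriv_eq_of_eqOn_real hFf hx (hF.differentiableAt (hU.mem_nhds (hxU x hx))) (hfd x hx)
  have hF' : DifferentiableOn ℂ (deriv F) U := hF.deriv hU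
  refine ⟨U ∩ deriv F ⁻¹' {0}ᶜ, fun z => (deriv F z)⁻¹,
    hF'.continuousOn.isOpen_inter_preimage hU isOpen_compl_singleton, fun x hx => ⟨hxU x hx, ?_⟩,
    (hF'.mono inter_subset_left).inv fun z hz => hz.2, fun x hx => ?_⟩
  · rw [mem_preimage, hd x hx]
    simpa using hf' x hx
  · simp only [hd x hx]
    push_cast
    rfl

variable {n : ℕ}

theorem smul_one_sub_inv_apply {A : Matrix (Fin n) (Fin n) ℂ} (hA : A.IsHermitian) {z : ℂ}
    (hz : ∀ i, z ≠ hA.eigenvalues i) (s t : Fin n) :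
    (z • (1 : Matrix (Fin n) (Fin n) ℂ) - A)⁻¹ s t
      = ∑ k, (hA.eigenvectorUnitary : Matrix (Fin n) (Fin n) ℂ) s k *
          (starRingEnd ℂ) ((hA.eigenvectorUnitary : Matrix (Fin n) (Fin n) ℂ) t k) *
            (z - hA.eigenvalues k)⁻¹ := by
  set V := (hA.eigenvectorUnitary : Matrix (Fin n) (Fin n) ℂ) with hV
  have hVV : V * star V = 1 := Unitary.mul_star_self_of_mem hA.eigenvectorUnitary.2
  have hVV' : star V * V = 1 := Unitary.star_mul_self_of_mem hA.eigenvectorUnitary.2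
  have hspec : z • (1 : Matrix (Fin n) (Fin n) ℂ) - A
      = V * Matrix.diagonal (fun k => z - (hA.eigenvalues k : ℂ)) * star V := by
    have h1 : A = V * Matrix.diagonal (fun k => (hA.eigenvalues k : ℂ)) * star V := by
      conv_lhs => rw [hA.spectral_theorem, Unitary.conjStarAlgAut_apply]
      rfl
    have h2 : Matrix.diagonal (fun k => z - (hA.eigenvalues k : ℂ))
        = z • (1 : Matrix (Fin n) (Fin n) ℂ)
          - Matrix.diagonal (fun k => (hA.eigenvalues k : ℂ)) := by
      rw [Matrix.smul_one_eq_diagonal, Matrix.diagonal_sub]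
    rw [h2, Matrix.mul_sub, Matrix.sub_mul, ← h1, Matrix.mul_smul, Matrix.mul_one,
      Matrix.smul_mul, hVV]
  have hinv : (z • (1 : Matrix (Fin n) (Fin n) ℂ) - A)⁻¹
      = V * Matrix.diagonal (fun k => (z - (hA.eigenvalues k : ℂ))⁻¹) * star V := by
    refine Matrix.inv_eq_right_inv ?_
    have h3 : Matrix.diagonal (fun k => z - (hA.eigenvalues k : ℂ)) *
        Matrix.diagonal (fun k => (z - (hA.eigenvalues k : ℂ))⁻¹) = 1 := by
      rw [Matrix.diagonal_mul_diagonal, ← Matrix.diagonal_one]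
      congr 1
      funext k
      exact mul_inv_cancel₀ (sub_ne_zero.2 (hz k))
    rw [hspec]
    calc _ = V * (Matrix.diagonal (fun k => z - (hA.eigenvalues k : ℂ)) * (star V * V) *
          Matrix.diagonal (fun k => (z - (hA.eigenvalues k : ℂ))⁻¹)) * star V := by
          simp only [Matrix.mul_assoc]
      _ = 1 := by rw [hVV', Matrix.mul_one, h3, Matrix.mul_one, hVV]
  rw [hinv, Matrix.mul_apply]
  refine Finset.sum_congr rfl fun k _ => ?_
  rw [Matrix.mul_diagonal, Matrix.star_eq_conjTranspose, Matrix.conjTranspose_apply]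
  simp only [RCLike.star_def]
  ring

theorem cfc_apply_eq_sum {𝕜 : Type*} [RCLike 𝕜] {A : Matrix (Fin n) (Fin n) 𝕜}
    (hA : A.IsHermitian) (f : ℝ → ℝ) (s t : Fin n) :
    cfc f A s t = ∑ k, (hA.eigenvectorUnitary : Matrix (Fin n) (Fin n) 𝕜) s k *
      (starRingEnd 𝕜) ((hA.eigenvectorUnitary : Matrix (Fin n) (Fin n) 𝕜) t k) *
        (f (hA.eigenvalues k) : 𝕜) := by
  rw [hA.cfc_eq, Matrix.IsHermitian.cfc, Unitary.conjStarAlgAut_apply, Matrix.mul_apply]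
  refine Finset.sum_congr rfl fun k _ => ?_
  rw [Matrix.mul_diagonal, Matrix.star_eq_conjTranspose, Matrix.conjTranspose_apply]
  simp only [Function.comp_apply, RCLike.star_def]
  ring

/-- The entries of `f (A x)` are smooth functions of `x`, where `A` is a smooth family of Hermitian
matrices with eigenvalues in `]0,1[`. -/
theorem contDiffAt_cfc_apply_complex {d : ℕ} {f : ℝ → ℝ} (hf : HasHolomorphicExtension f)
    {A : (Fin d → ℝ) → Matrix (Fin n) (Fin n) ℂ} (N : ℕ)
    (hA : ∀ s t, ContDiff ℝ N fun x => A x s t)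
    (hH : ∀ x, (A x).IsHermitian) {x₀ : Fin d → ℝ}
    (h0 : ∀ i, (hH x₀).eigenvalues i ∈ Ioo (0 : ℝ) 1) (s t : Fin n) :
    ContDiffAt ℝ N (fun x => cfc f (A x) s t) x₀ := by
  have hAc : Continuous A := continuous_matrix fun i j => (hA i j).continuous
  obtain ⟨U, F, hU, hxU, hF, hFf⟩ := hf
  set S : Finset ℝ := Finset.univ.image (hH x₀).eigenvalues with hS
  have hS01 : ∀ c ∈ S, c ∈ Ioo (0 : ℝ) 1 := by
    intro c hc
    obtain ⟨i, -, rfl⟩ := Finset.mem_image.1 hc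
    exact h0 i
  -- One radius for all distinct eigenvalues at `x₀`: the closed discs lie in `U`, are pairwise
  -- disjoint, and meet the real axis inside `]0,1[` except possibly at their end points, so `F = f`
  -- at nearby eigenvalues.
  obtain ⟨ε, ⟨⟨hεU, hεS⟩, hε01⟩, hε⟩ : ∃ ε : ℝ, (((∀ c ∈ S, closedBall (c : ℂ) ε ⊆ U) ∧
      ∀ c ∈ S, ∀ c' ∈ S, c ≠ c' → 2 * ε < dist c c') ∧ ∀ c ∈ S, ball c ε ⊆ Ioo (0 : ℝ) 1) ∧
        0 < ε := by
    have hlt : ∀ r : ℝ, 0 < r → ∀ᶠ ε in 𝓝[>] (0 : ℝ), ε < r := fun r hr =>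
      (gt_mem_nhds hr).filter_mono nhdsWithin_le_nhds
    have e1 : ∀ᶠ ε in 𝓝[>] (0 : ℝ), ∀ c ∈ S, closedBall (c : ℂ) ε ⊆ U :=
      (Finset.eventually_all S).2 fun c hc => by
        obtain ⟨r, hr, hrU⟩ := nhds_basis_closedBall.mem_iff.1 (hU.mem_nhds (hxU c (hS01 c hc)))
        exact (hlt r hr).mono fun ε h => (closedBall_subset_closedBall h.le).trans hrU
    have e2 : ∀ᶠ ε in 𝓝[>] (0 : ℝ), ∀ c ∈ S, ∀ c' ∈ S, c ≠ c' → 2 * ε < dist c c' :=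
      (Finset.eventually_all S).2 fun c _ => (Finset.eventually_all S).2 fun c' _ => by
        by_cases h : c = c'
        · simp [h]
        · exact (hlt (dist c c' / 2) (by simpa using h)).mono fun ε h _ => by linarith
    have e3 : ∀ᶠ ε in 𝓝[>] (0 : ℝ), ∀ c ∈ S, ball c ε ⊆ Ioo (0 : ℝ) 1 :=
      (Finset.eventually_all S).2 fun c hc => by
        obtain ⟨r, hr, hrU⟩ := nhds_basis_ball.mem_iff.1 (isOpen_Ioo.mem_nhds (hS01 c hc))
        exact (hlt r hr).mono fun ε h => (ball_subset_ball h.le).trans hrU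
    exact (((e1.and e2).and e3).and self_mem_nhdsWithin).exists
  -- The circles avoid the spectrum of `A x₀`, and by compactness also that of all nearby `A x`.
  have hdet : ∀ c ∈ S, ∀ᶠ x in 𝓝 x₀, ∀ z ∈ sphere (c : ℂ) ε,
      (z • (1 : Matrix (Fin n) (Fin n) ℂ) - A x).det ≠ 0 := by
    intro c hc
    refine (isCompact_sphere _ _).eventually_forall_of_forall_eventually fun z hz => ?_
    have hcont : Continuous fun w : (Fin d → ℝ) × ℂ =>
        (w.2 • (1 : Matrix (Fin n) (Fin n) ℂ) - A w.1).det := by fun_prop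
    refine hcont.continuousAt.eventually_ne ?_
    simp only [det_smul_one_sub (hH x₀)]
    refine Finset.prod_ne_zero_iff.2 fun i _ => sub_ne_zero.2 ?_
    rintro rfl
    have hi : (hH x₀).eigenvalues i ∈ S := Finset.mem_image_of_mem _ (Finset.mem_univ i)
    have hz' : dist ((hH x₀).eigenvalues i) c = ε := by
      rw [mem_sphere, Complex.dist_of_im_eq (by simp)] at hz
      simpa using hz
    by_cases h : (hH x₀).eigenvalues i = c
    · rw [h, dist_self] at hz'
      exact hε.ne hz'
    · have := hεS _ hi c hc h
      linarith
  have heig : ∀ᶠ x in 𝓝 x₀, ∀ i, (hH x).eigenvalues i ∈ ⋃ c ∈ S, ball c ε :=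
    eventually_eigenvalues_mem hAc.continuousAt hH
      (isOpen_biUnion fun c _ => isOpen_ball) fun i =>
        mem_biUnion (Finset.mem_image_of_mem _ (Finset.mem_univ i)) (mem_ball_self hε)
  -- The Riesz–Dunford formula. Each eigenvalue of `A x` lies in exactly one disc, where Cauchy's
  -- formula returns `f`; around the other discs the integrand is holomorphic and contributes zero.
  -- The circles do not depend on `x`, so crossings of eigenvalues do no harm.
  have hform : (fun x => cfc f (A x) s t) =ᶠ[𝓝 x₀] fun x => ∑ c ∈ S,
      (2 * Real.pi * Complex.I : ℂ)⁻¹ * ∮ z in C((c : ℂ), ε),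
        F z * (z • (1 : Matrix (Fin n) (Fin n) ℂ) - A x)⁻¹ s t := by
    filter_upwards [heig, (Finset.eventually_all S).2 hdet] with x hx hxdet
    have hne : ∀ c ∈ S, ∀ z ∈ sphere (c : ℂ) ε, ∀ i, z ≠ (hH x).eigenvalues i := by
      intro c hc z hz i h
      refine hxdet c hc z hz ?_
      rw [det_smul_one_sub (hH x)]
      exact Finset.prod_eq_zero (Finset.mem_univ i) (sub_eq_zero.2 h)
    have hcauchy : ∀ k, ∑ c ∈ S, (2 * Real.pi * Complex.I : ℂ)⁻¹ *
        ∮ z in C((c : ℂ), ε), (z - (hH x).eigenvalues k)⁻¹ • F z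
          = (f ((hH x).eigenvalues k) : ℂ) := by
      intro k
      set μ := (hH x).eigenvalues k with hμ
      obtain ⟨c, hc, hμc⟩ := mem_iUnion₂.1 (hx k)
      have hball : ∀ c' : ℝ, (μ : ℂ) ∈ closedBall (c' : ℂ) ε ↔ dist μ c' ≤ ε := by
        intro c'
        rw [mem_closedBall, Complex.dist_of_im_eq (by simp)]
        simp
      rw [Finset.sum_eq_single_of_mem c hc]
      · have hμc' : (μ : ℂ) ∈ ball (c : ℂ) ε := by
          rw [mem_ball, Complex.dist_of_im_eq (by simp)]
          simpa using hμc
        have := Complex.two_pi_I_inv_smul_circleIntegral_sub_inv_smul_of_differentiable_on_off_countable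
          countable_empty hμc' (hF.continuousOn.mono (hεU c hc))
          (fun z hz => hF.differentiableAt (hU.mem_nhds (hεU c hc (ball_subset_closedBall hz.1))))
        rw [smul_eq_mul] at this
        rw [this]
        exact hFf μ (hε01 c hc hμc)
      · intro c' hc' hcc'
        have hout : (μ : ℂ) ∉ closedBall (c' : ℂ) ε := by
          rw [hball]
          intro h
          have h1 := hεS c' hc' c hc hcc'
          have h2 := dist_triangle_left c' c μ
          rw [mem_ball] at hμc
          linarith
        have hdiff : DifferentiableOn ℂ (fun z => (z - (μ : ℂ))⁻¹ • F z) (U \ {(μ : ℂ)}) := by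
          have h1 : DifferentiableOn ℂ (fun z => z - (μ : ℂ)) (U \ {(μ : ℂ)}) := by fun_prop
          exact (h1.inv fun z hz => sub_ne_zero.2 hz.2).smul (hF.mono sdiff_subset)
        have hsub : closedBall (c' : ℂ) ε ⊆ U \ {(μ : ℂ)} := fun z hz =>
          ⟨hεU c' hc' hz, fun h => hout (h ▸ hz)⟩
        rw [Complex.circleIntegral_eq_zero_of_differentiable_on_off_countable hε.le
          countable_empty (hdiff.continuousOn.mono hsub) (fun z hz => hdiff.differentiableAt
            ((hU.sdiff isClosed_singleton).mem_nhds (hsub (ball_subset_closedBall hz.1)))),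
          mul_zero]
    rw [cfc_apply_eq_sum (hH x)]
    have hterm : ∀ c ∈ S, ∮ z in C((c : ℂ), ε),
        F z * (z • (1 : Matrix (Fin n) (Fin n) ℂ) - A x)⁻¹ s t
        = ∑ k, ((hH x).eigenvectorUnitary : Matrix (Fin n) (Fin n) ℂ) s k *
          (starRingEnd ℂ) (((hH x).eigenvectorUnitary : Matrix (Fin n) (Fin n) ℂ) t k) *
            ∮ z in C((c : ℂ), ε), (z - (hH x).eigenvalues k)⁻¹ • F z := by
      intro c hc
      simp only [← circleIntegral.integral_const_mul]
      rw [← circleIntegral.integral_fun_sum]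
      · refine circleIntegral.integral_congr hε.le fun z hz => ?_
        simp only [smul_one_sub_inv_apply (hH x) (hne c hc z hz), Finset.mul_sum, smul_eq_mul]
        exact Finset.sum_congr rfl fun k _ => by ring
      · intro k _
        refine ContinuousOn.circleIntegrable hε.le (continuousOn_const.mul ?_)
        have h1 : ContinuousOn (fun z => z - ((hH x).eigenvalues k : ℂ)) (sphere (c : ℂ) ε) := by
          fun_prop
        exact (h1.inv₀ fun z hz => sub_ne_zero.2 (hne c hc z hz k)).smul
          (hF.continuousOn.mono (sphere_subset_closedBall.trans (hεU c hc)))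
    refine Eq.trans ?_ (Finset.sum_congr rfl fun c hc => congrArg _ (hterm c hc)).symm
    simp only [Finset.mul_sum]
    rw [Finset.sum_comm]
    refine Finset.sum_congr rfl fun k _ => ?_
    refine (congrArg _ (hcauchy k).symm).trans ?_
    rw [Finset.mul_sum]
    exact Finset.sum_congr rfl fun c _ => by ring
  refine ContDiffAt.congr_of_eventuallyEq ?_ hform
  refine ContDiffAt.sum fun c hc => contDiffAt_const.mul ?_
  obtain ⟨O, hOdet, hO, hxO⟩ := _root_.eventually_nhds_iff.1 (hdet c hc)
  refine ContDiffOn.contDiffAt (s := O) ?_ (hO.mem_nhds hxO)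
  refine contDiffOn_parametric_intervalIntegral hO N (Ψ := fun w : (Fin d → ℝ) × ℝ =>
    deriv (circleMap (c : ℂ) ε) w.2 • (F (circleMap c ε w.2) *
      (circleMap (c : ℂ) ε w.2 • (1 : Matrix (Fin n) (Fin n) ℂ) - A w.1)⁻¹ s t)) ?_ _ _
  rintro ⟨x, θ⟩ ⟨hx, -⟩
  refine ContDiffAt.contDiffWithinAt ?_
  have hsph : ∀ θ, circleMap (c : ℂ) ε θ ∈ sphere (c : ℂ) ε := circleMap_mem_sphere _ hε.le
  have hcm : ∀ c : ℂ, ContDiffAt ℝ N (fun w : (Fin d → ℝ) × ℝ => circleMap c ε w.2) (x, θ) :=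
    fun c => ((contDiff_circleMap c ε).comp contDiff_snd).contDiffAt
  simp only [smul_eq_mul]
  refine ContDiffAt.mul ?_ (ContDiffAt.mul ?_ ?_)
  · simp only [deriv_circleMap]
    exact (hcm 0).mul contDiffAt_const
  · have h1 : ContDiffAt ℂ N F (circleMap c ε θ) := (hF.analyticAt (hU.mem_nhds (hεU c hc
      (sphere_subset_closedBall (hsph θ))))).contDiffAt
    exact ContDiffAt.comp (g := F) (f := fun w : (Fin d → ℝ) × ℝ => circleMap c ε w.2) (x, θ)
      (h1.restrict_scalars ℝ) (hcm c)
  · have hd : (circleMap (c : ℂ) ε θ • (1 : Matrix (Fin n) (Fin n) ℂ) - A x).det ≠ 0 :=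
      hOdet x hx (circleMap (c : ℂ) ε θ) (hsph θ)
    refine ContDiffAt.matrix_inv_apply (𝔸 := ℂ) (x := (x, θ)) (G := fun w : (Fin d → ℝ) × ℝ =>
      circleMap (c : ℂ) ε w.2 • (1 : Matrix (Fin n) (Fin n) ℂ) - A w.1) (fun i j => ?_) hd s t
    have h2 : ContDiffAt ℝ N (fun w : (Fin d → ℝ) × ℝ => A w.1 i j) (x, θ) :=
      ((hA i j).comp contDiff_fst).contDiffAt
    have h3 : ContDiffAt ℝ N (fun w : (Fin d → ℝ) × ℝ => circleMap (c : ℂ) ε w.2 *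
        (1 : Matrix (Fin n) (Fin n) ℂ) i j) (x, θ) := (hcm c).mul contDiffAt_const
    exact h3.sub h2

end SmoothFunctionalCalculus

end

noncomputable section

/-! ### The derivative of the functional calculus. -/

section DerivFunctionalCalculus

open Set

variable {𝕜 : Type} [RCLike 𝕜] {n : ℕ}

variable (𝕜) in
/-- The embedding of `ℝ` or `ℂ` into `ℂ`. -/
def rclikeToComplex : 𝕜 →ₐ[ℝ] ℂ where
  toFun x := ⟨RCLike.re x, RCLike.im x⟩
  map_one' := by apply Complex.ext <;> simp
  map_mul' x y := by apply Complex.ext <;> simp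
  map_zero' := by apply Complex.ext <;> simp
  map_add' x y := by apply Complex.ext <;> simp
  commutes' r := by apply Complex.ext <;> simp [RCLike.algebraMap_eq_ofReal]

variable (𝕜 n) in
/-- The embedding of real or complex matrices into complex matrices. -/
def matrixToComplex : Matrix (Fin n) (Fin n) 𝕜 →⋆ₐ[ℝ] Matrix (Fin n) (Fin n) ℂ where
  toAlgHom := (rclikeToComplex 𝕜).mapMatrix
  map_star' A := by
    ext i j
    apply Complex.ext <;> simp [rclikeToComplex, Matrix.star_apply]

theorem matrixToComplex_apply (A : Matrix (Fin n) (Fin n) 𝕜) (i j : Fin n) :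
    matrixToComplex 𝕜 n A i j = ⟨RCLike.re (A i j), RCLike.im (A i j)⟩ := rfl

theorem isHermitian_matrixToComplex {A : Matrix (Fin n) (Fin n) 𝕜} (hA : A.IsHermitian) :
    (matrixToComplex 𝕜 n A).IsHermitian :=
  IsSelfAdjoint.map (show IsSelfAdjoint A from hA) (matrixToComplex 𝕜 n)

theorem continuous_matrixToComplex : Continuous (matrixToComplex 𝕜 n) := by
  refine continuous_matrix fun i j => ?_
  have : (fun A : Matrix (Fin n) (Fin n) 𝕜 => matrixToComplex 𝕜 n A i j)
      = fun A => (RCLike.re (A i j) : ℂ) + (RCLike.im (A i j) : ℂ) * Complex.I := by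
    funext A
    apply Complex.ext <;> simp [matrixToComplex_apply]
  rw [this]
  have h : Continuous fun A : Matrix (Fin n) (Fin n) 𝕜 => A i j := continuous_id.matrix_elem i j
  exact (Complex.continuous_ofReal.comp (RCLike.continuous_re.comp h)).add
    ((Complex.continuous_ofReal.comp (RCLike.continuous_im.comp h)).mul continuous_const)

theorem continuousOn_spectrum (A : Matrix (Fin n) (Fin n) 𝕜) (f : ℝ → ℝ) :
    ContinuousOn f (spectrum ℝ A) :=
  A.finite_real_spectrum.continuousOn f

theorem cfc_matrixToComplex {A : Matrix (Fin n) (Fin n) 𝕜} (hA : A.IsHermitian) (f : ℝ → ℝ) :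
    matrixToComplex 𝕜 n (cfc f A) = cfc f (matrixToComplex 𝕜 n A) :=
  StarAlgHom.map_cfc (S := ℝ) (matrixToComplex 𝕜 n) f A (continuousOn_spectrum A f)
    continuous_matrixToComplex hA (isHermitian_matrixToComplex hA)

/-- The functional calculus commutes with the star homomorphism into complex matrices, and an
algebra homomorphism does not enlarge the spectrum; so the complex case applies and the entries are
recovered from real and imaginary parts. -/
theorem contDiffAt_cfc_apply {d : ℕ} {f : ℝ → ℝ} (hf : HasHolomorphicExtension f)
    {A : (Fin d → ℝ) → Matrix (Fin n) (Fin n) 𝕜} (N : ℕ)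
    (hA : ∀ s t, ContDiff ℝ N fun x => A x s t)
    (hH : ∀ x, (A x).IsHermitian) {x₀ : Fin d → ℝ}
    (h0 : ∀ i, (hH x₀).eigenvalues i ∈ Ioo (0 : ℝ) 1) (s t : Fin n) :
    ContDiffAt ℝ N (fun x => cfc f (A x) s t) x₀ := by
  have hre : ∀ s t, ContDiff ℝ N fun x => RCLike.re (A x s t) := fun s t =>
    (RCLike.reCLM (K := 𝕜)).contDiff.comp (hA s t)
  have him : ∀ s t, ContDiff ℝ N fun x => RCLike.im (A x s t) := fun s t =>
    (RCLike.imCLM (K := 𝕜)).contDiff.comp (hA s t)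
  have h1 := contDiffAt_cfc_apply_complex hf (A := fun x => matrixToComplex 𝕜 n (A x)) N
    (fun s t => by
      have : (fun x => matrixToComplex 𝕜 n (A x) s t)
          = fun x => (RCLike.re (A x s t) : ℂ) + (RCLike.im (A x s t) : ℂ) * Complex.I := by
        funext x
        apply Complex.ext <;> simp [matrixToComplex_apply]
      rw [this]
      exact (Complex.ofRealCLM.contDiff.comp (hre s t)).add
        ((Complex.ofRealCLM.contDiff.comp (him s t)).mul contDiff_const))
    (fun x => isHermitian_matrixToComplex (hH x)) (x₀ := x₀)
    (fun i => by
      have h2 := (isHermitian_matrixToComplex (hH x₀)).eigenvalues_mem_spectrum_real i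
      have h3 := AlgHom.spectrum_apply_subset (R := ℝ) (matrixToComplex 𝕜 n) (A x₀) h2
      rw [(hH x₀).spectrum_real_eq_range_eigenvalues] at h3
      obtain ⟨j, hj⟩ := h3
      rw [← hj]
      exact h0 j) s t
  have h4 : (fun x => cfc f (A x) s t) = fun x =>
      (((cfc f (matrixToComplex 𝕜 n (A x)) s t).re : ℝ) : 𝕜)
        + (((cfc f (matrixToComplex 𝕜 n (A x)) s t).im : ℝ) : 𝕜) * RCLike.I := by
    funext x
    rw [← cfc_matrixToComplex (hH x), matrixToComplex_apply]
    exact (RCLike.re_add_im _).symm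
  rw [h4]
  exact ((RCLike.ofRealCLM (K := 𝕜)).contDiff.contDiffAt.comp x₀
      (Complex.reCLM.contDiff.contDiffAt.comp x₀ h1)).add
    (((RCLike.ofRealCLM (K := 𝕜)).contDiff.contDiffAt.comp x₀
      (Complex.imCLM.contDiff.contDiffAt.comp x₀ h1)).mul contDiffAt_const)

theorem isHermitian_add_smul {D X : Matrix (Fin n) (Fin n) 𝕜} (hD : D.IsHermitian)
    (hX : X.IsHermitian) (t : ℝ) : (D + t • X).IsHermitian := by
  refine hD.add ?_
  unfold Matrix.IsHermitian
  rw [Matrix.conjTranspose_smul, hX.eq, star_trivial]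

theorem isHermitian_cfc (f : ℝ → ℝ) (A : Matrix (Fin n) (Fin n) 𝕜) : (cfc f A).IsHermitian :=
  cfc_predicate f A

theorem differentiableAt_cfc_add_smul_apply {f : ℝ → ℝ} (hf : HasHolomorphicExtension f)
    {D X : Matrix (Fin n) (Fin n) 𝕜} (hD : D.IsHermitian)
    (h0 : ∀ i, hD.eigenvalues i ∈ Ioo (0 : ℝ) 1) (hX : X.IsHermitian) (i j : Fin n) :
    DifferentiableAt ℝ (fun t : ℝ => cfc f (D + t • X) i j) 0 := by
  have hH : ∀ x : Fin 1 → ℝ, (D + x 0 • X).IsHermitian := fun x => isHermitian_add_smul hD hX _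
  have h1 := contDiffAt_cfc_apply hf (A := fun x : Fin 1 → ℝ => D + x 0 • X) 1
    (fun s t => by simp only [Matrix.add_apply, Matrix.smul_apply]; fun_prop) hH (x₀ := 0)
    (fun i => by simpa using h0 i) i j
  exact DifferentiableAt.comp (f := fun (t : ℝ) (_ : Fin 1) => t) (0 : ℝ)
    (h1.differentiableAt (by norm_num)) (by fun_prop)

/-- The matrix `A` in the eigenbasis of the Hermitian matrix `D`. -/
def inEigenbasis {D : Matrix (Fin n) (Fin n) 𝕜} (hD : D.IsHermitian)
    (A : Matrix (Fin n) (Fin n) 𝕜) : Matrix (Fin n) (Fin n) 𝕜 :=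
  star (hD.eigenvectorUnitary : Matrix (Fin n) (Fin n) 𝕜) * A * hD.eigenvectorUnitary

theorem inEigenbasis_cfc {D : Matrix (Fin n) (Fin n) 𝕜} (hD : D.IsHermitian) (f : ℝ → ℝ) :
    inEigenbasis hD (cfc f D) = Matrix.diagonal fun i => (f (hD.eigenvalues i) : 𝕜) := by
  have hVV' : star (hD.eigenvectorUnitary : Matrix (Fin n) (Fin n) 𝕜) * hD.eigenvectorUnitary = 1 :=
    Unitary.star_mul_self_of_mem hD.eigenvectorUnitary.2
  rw [inEigenbasis, hD.cfc_eq, Matrix.IsHermitian.cfc, Unitary.conjStarAlgAut_apply]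
  simp only [← Matrix.mul_assoc]
  rw [hVV', Matrix.one_mul, Matrix.mul_assoc, hVV', Matrix.mul_one]
  rfl

theorem inEigenbasis_mul {D : Matrix (Fin n) (Fin n) 𝕜} (hD : D.IsHermitian)
    (A B : Matrix (Fin n) (Fin n) 𝕜) :
    inEigenbasis hD (A * B) = inEigenbasis hD A * inEigenbasis hD B := by
  have hVV : (hD.eigenvectorUnitary : Matrix (Fin n) (Fin n) 𝕜) *
      star (hD.eigenvectorUnitary : Matrix (Fin n) (Fin n) 𝕜) = 1 :=
    Unitary.mul_star_self_of_mem hD.eigenvectorUnitary.2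
  unfold inEigenbasis
  simp only [Matrix.mul_assoc]
  rw [← Matrix.mul_assoc (hD.eigenvectorUnitary : Matrix (Fin n) (Fin n) 𝕜) (star _), hVV,
    Matrix.one_mul]

theorem trace_inEigenbasis {D : Matrix (Fin n) (Fin n) 𝕜} (hD : D.IsHermitian)
    (A : Matrix (Fin n) (Fin n) 𝕜) : (inEigenbasis hD A).trace = A.trace := by
  have hVV : (hD.eigenvectorUnitary : Matrix (Fin n) (Fin n) 𝕜) *
      star (hD.eigenvectorUnitary : Matrix (Fin n) (Fin n) 𝕜) = 1 :=
    Unitary.mul_star_self_of_mem hD.eigenvectorUnitary.2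
  rw [inEigenbasis, Matrix.mul_assoc, Matrix.trace_mul_comm, Matrix.mul_assoc, hVV, Matrix.mul_one]

theorem isHermitian_inEigenbasis {D A : Matrix (Fin n) (Fin n) 𝕜} (hD : D.IsHermitian)
    (hA : A.IsHermitian) : (inEigenbasis hD A).IsHermitian := by
  rw [inEigenbasis, Matrix.star_eq_conjTranspose]
  exact Matrix.isHermitian_conjTranspose_mul_mul _ hA

theorem inEigenbasis_apply {D : Matrix (Fin n) (Fin n) 𝕜} (hD : D.IsHermitian)
    (A : Matrix (Fin n) (Fin n) 𝕜) (i j : Fin n) :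
    inEigenbasis hD A i j = ∑ l, ∑ k, star ((hD.eigenvectorUnitary : Matrix (Fin n) (Fin n) 𝕜) k i)
      * A k l * (hD.eigenvectorUnitary : Matrix (Fin n) (Fin n) 𝕜) l j := by
  simp only [inEigenbasis, Matrix.mul_apply, Finset.sum_mul, Matrix.star_apply]

theorem inEigenbasis_add {D : Matrix (Fin n) (Fin n) 𝕜} (hD : D.IsHermitian)
    (A B : Matrix (Fin n) (Fin n) 𝕜) :
    inEigenbasis hD (A + B) = inEigenbasis hD A + inEigenbasis hD B := by
  simp only [inEigenbasis, Matrix.mul_add, Matrix.add_mul]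

theorem inEigenbasis_smul {D : Matrix (Fin n) (Fin n) 𝕜} (hD : D.IsHermitian) (r : ℝ)
    (A : Matrix (Fin n) (Fin n) 𝕜) : inEigenbasis hD (r • A) = r • inEigenbasis hD A := by
  simp only [inEigenbasis, Matrix.mul_smul, Matrix.smul_mul]

theorem inEigenbasis_algebraMap {D : Matrix (Fin n) (Fin n) 𝕜} (hD : D.IsHermitian) (r : ℝ) :
    inEigenbasis hD (algebraMap ℝ _ r) = algebraMap ℝ _ r := by
  have hVV' : star (hD.eigenvectorUnitary : Matrix (Fin n) (Fin n) 𝕜) * hD.eigenvectorUnitary = 1 :=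
    Unitary.star_mul_self_of_mem hD.eigenvectorUnitary.2
  rw [Algebra.algebraMap_eq_smul_one, inEigenbasis_smul, inEigenbasis, Matrix.mul_one, hVV']

/-- This is `f(x) = f(c) + (x - c) f[c, x]` under the functional calculus. It holds for arbitrary
`f`, because every function is continuous on a finite spectrum. -/
theorem cfc_eq_add_mul_cfc_dslope {A : Matrix (Fin n) (Fin n) 𝕜} (hA : A.IsHermitian) (f : ℝ → ℝ)
    (c : ℝ) : cfc f A = algebraMap ℝ _ (f c) + (A - algebraMap ℝ _ c) * cfc (dslope f c) A := by
  have hA' : IsSelfAdjoint A := hA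
  have h : f = fun x => f c + (x - c) * dslope f c x := by
    funext x
    have := sub_smul_dslope f c x
    rw [smul_eq_mul] at this
    rw [this]
    ring
  have h1 := continuousOn_spectrum A
  conv_lhs => rw [h]
  rw [cfc_const_add (f c) _ A (h1 _), cfc_mul _ _ A (h1 _) (h1 _),
    cfc_sub (fun x => x) (fun _ => c) A (h1 _) (h1 _), cfc_id' ℝ A, cfc_const c A]

/-- The directional derivative of the functional calculus, in the eigenbasis. -/
theorem hasDerivAt_inEigenbasis_cfc {f : ℝ → ℝ} (hf : HasHolomorphicExtension f)
    {D X : Matrix (Fin n) (Fin n) 𝕜} (hD : D.IsHermitian)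
    (h0 : ∀ i, hD.eigenvalues i ∈ Ioo (0 : ℝ) 1) (hX : X.IsHermitian) (i j : Fin n) :
    HasDerivAt (fun t : ℝ => inEigenbasis hD (cfc f (D + t • X)) i j)
      (dslope f (hD.eigenvalues i) (hD.eigenvalues j) • inEigenbasis hD X i j) 0 := by
  set c := hD.eigenvalues i with hc
  -- Expanding at `c = λᵢ` makes the `i`-th row of `D - c` vanish in the eigenbasis. The explicit
  -- factor `t` then reduces differentiability at `0` to continuity of the cofactor, without any
  -- perturbation of eigenvectors.
  have key : ∀ t : ℝ, inEigenbasis hD (cfc f (D + t • X)) i j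
      = (algebraMap ℝ (Matrix (Fin n) (Fin n) 𝕜) (f c)) i j
        + t • inEigenbasis hD (X * cfc (dslope f c) (D + t • X)) i j := by
    intro t
    set W := cfc (dslope f c) (D + t • X) with hW
    have hrow : inEigenbasis hD ((D - algebraMap ℝ _ c) * W) i j = 0 := by
      have hfun : D - algebraMap ℝ _ c = cfc (fun x => x - c) D := by
        have h1 := continuousOn_spectrum D
        have hD' : IsSelfAdjoint D := hD
        rw [cfc_sub (fun x => x) (fun _ => c) D (h1 _) (h1 _), cfc_id' ℝ D, cfc_const c D]
      rw [inEigenbasis_mul, hfun, inEigenbasis_cfc, Matrix.diagonal_mul, ← hc, sub_self]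
      simp
    have hsplit : (D + t • X - algebraMap ℝ _ c) * W
        = (D - algebraMap ℝ _ c) * W + t • (X * W) := by
      rw [← Matrix.smul_mul, ← Matrix.add_mul]
      congr 1
      abel
    rw [cfc_eq_add_mul_cfc_dslope (isHermitian_add_smul hD hX t) f c, ← hW, hsplit,
      inEigenbasis_add, inEigenbasis_add, inEigenbasis_algebraMap, inEigenbasis_smul,
      Matrix.add_apply, Matrix.add_apply, hrow, zero_add, Matrix.smul_apply]
  simp only [key]
  have hcont : ContinuousAt (fun t : ℝ => inEigenbasis hD (X * cfc (dslope f c) (D + t • X)) i j)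
      0 := by
    simp only [inEigenbasis_apply, Matrix.mul_apply]
    have := fun k l =>
      (differentiableAt_cfc_add_smul_apply (hf.dslope (h0 i)) hD h0 hX k l).continuousAt
    fun_prop
  have h0 : inEigenbasis hD (X * cfc (dslope f c) (D + (0 : ℝ) • X)) i j
      = dslope f c (hD.eigenvalues j) • inEigenbasis hD X i j := by
    rw [zero_smul, add_zero, inEigenbasis_mul, inEigenbasis_cfc, Matrix.mul_diagonal,
      RCLike.real_smul_eq_coe_mul, mul_comm]
  rw [← h0]
  refine HasDerivAt.const_add _ (hasDerivAt_iff_tendsto_slope.2 ?_)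
  refine (hcont.tendsto.mono_left nhdsWithin_le_nhds).congr' ?_
  filter_upwards [self_mem_nhdsWithin] with t ht
  rw [slope_def_module, zero_smul, sub_zero, sub_zero, smul_smul, inv_mul_cancel₀ ht, one_smul]

end DerivFunctionalCalculus

end

noncomputable section

/-! ### Hypersurfaces with diagonal and off-diagonal coordinates. -/

section AdaptedCoordinates

variable {E : Type*} [AddCommGroup E] [Module ℝ E] {T : Submodule ℝ E} {d : ℕ}
  {b : Module.Basis (Fin d) ℝ T} {g : E → E → E → ℝ} {p : E} {n : ℕ} {κ : Type*} [Fintype κ]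
  [DecidableEq κ]

/-- The scalar curvature at a point where the derivatives of the immersion `y` and of its normal
field `N` are diagonal in the linear coordinates `co`. -/
theorem scalarCurvature_of_diagonal_derivatives [NeZero n] {f : ℝ → ℝ} {l : Fin n → ℝ}
    (hf' : ∀ k, deriv f (l k) ≠ 0) {y N : (Fin d → ℝ) → Fin n ⊕ κ → ℝ}
    (hy : ContDiffAt ℝ 3 y 0)
    (hg : ∀ᶠ x in 𝓝 0, ∀ i j,
      g (affineChart b p x) (b i) (b j) = pderiv i y x ⬝ᵥ pderiv j y x)
    (hN : DifferentiableAt ℝ N 0) (horth : ∀ᶠ x in 𝓝 0, ∀ i, pderiv i y x ⬝ᵥ N x = 0)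
    (co : E →ₗ[ℝ] (Fin n ⊕ κ → ℝ)) {s ρ : Fin n ⊕ κ → ℝ} (hs : ∀ a, s a ≠ 0)
    (hs' : ∀ k, s (.inl k) = deriv f (l k))
    (hρ : ∀ k, ρ (.inl k) = -(deriv (deriv f) (l k) / deriv f (l k) ^ 3))
    (hpy : ∀ i a, pderiv i y 0 a = s a * co (b i) a)
    (hpN : ∀ i a, pderiv i N 0 a = ρ a * (s a * co (b i) a))
    (hNl : ∀ k, N 0 (.inl k) = (deriv f (l k))⁻¹) (hNr : ∀ a, N 0 (.inr a) = 0)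
    (hinj : ∀ X ∈ T, co X = 0 → X = 0)
    (hsurj : ∀ w : Fin n ⊕ κ → ℝ, ∑ k, w (.inl k) = 0 → ∃ X ∈ T, co X = w) :
    scalarCurvature b g p =
      4 / cNorm f l ^ 4 * (diagDoubleSum f l - diagSum f l * ∑ a, ρ (.inr a))
        + (∑ a, ρ (.inr a)) ^ 2 / cNorm f l ^ 2 - (∑ a, ρ (.inr a) ^ 2) / cNorm f l ^ 2 := by
  have hc : N 0 ⬝ᵥ N 0 = cNorm f l ^ 2 := by
    rw [cNorm_sq, dotProduct, Fintype.sum_sum_type]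
    simp only [hNl, hNr, mul_zero, Finset.sum_const_zero, add_zero]
    exact Finset.sum_congr rfl fun k _ => by rw [one_div, ← mul_inv, sq]
  have hc0 : cNorm f l ^ 2 ≠ 0 := by
    rw [cNorm_sq]
    refine (Finset.sum_pos (fun k _ => ?_) Finset.univ_nonempty).ne'
    have := hf' k
    positivity
  have main := scalarCurvature_hypersurface (b := b) (g := g) (y := y) (N := N) (p := p)
    (ρ := ρ) hy hg
    (by
      rw [Fintype.linearIndependent_iff]
      intro a ha
      have hz : (∑ i, a i • (b i : E)) = 0 := by
        refine hinj _ (Submodule.sum_mem _ fun i _ => T.smul_mem _ (b i).2) (funext fun k => ?_)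
        have h1 := congrFun ha k
        simp only [Finset.sum_apply, Pi.smul_apply, smul_eq_mul, hpy, Pi.zero_apply] at h1
        refine mul_left_cancel₀ (hs k) ?_
        rw [Pi.zero_apply, mul_zero, ← h1]
        simp only [map_sum, map_smul, Finset.sum_apply, Pi.smul_apply, smul_eq_mul,
          Finset.mul_sum]
        exact Finset.sum_congr rfl fun i _ => by ring
      have hz' : ∑ i, a i • b i = 0 := Subtype.ext (by simpa using hz)
      exact Fintype.linearIndependent_iff.1 b.linearIndependent a hz')
    hN horth (hc ▸ hc0)
    (by
      intro v hv
      have hT0 : ∀ X ∈ T, ∑ k, s k * v k * co X k = 0 := by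
        intro X hX
        obtain ⟨a, rfl⟩ := exists_eq_sum_smul_basis b hX
        have h1 : ∑ i, a i * (pderiv i y 0 ⬝ᵥ v) = 0 := by simp [hv]
        rw [← h1]
        simp only [map_sum, map_smul, Finset.sum_apply, Pi.smul_apply, smul_eq_mul,
          Finset.mul_sum, dotProduct, hpy]
        rw [Finset.sum_comm]
        exact Finset.sum_congr rfl fun i _ => Finset.sum_congr rfl fun k _ => by ring
      -- Diagonal components are compared with the zeroth one through trace-free differences. Each
      -- off-diagonal coordinate vector is itself tangent, which forces that component of `v` to
      -- vanish.
      refine ⟨deriv f (l 0) * v (.inl 0), funext fun a => ?_⟩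
      rw [Pi.smul_apply, smul_eq_mul]
      cases a with
      | inl k =>
        have hk : deriv f (l k) * v (.inl k) = deriv f (l 0) * v (.inl 0) := by
          obtain ⟨X, hX, hXk⟩ := hsurj (Pi.single (.inl k) 1 - Pi.single (.inl 0) 1) (by
            simp [Finset.sum_sub_distrib, Pi.single_apply])
          have := hT0 X hX
          simp only [hXk, Pi.sub_apply, mul_sub, Finset.sum_sub_distrib, Pi.single_apply,
            mul_ite, mul_one, mul_zero, Finset.sum_ite_eq', Finset.mem_univ, if_true, hs'] at this
          linarith
        rw [hNl, ← hk, mul_comm (deriv f (l k)), mul_inv_cancel_right₀ (hf' k)]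
      | inr a =>
        obtain ⟨X, hX, hXk⟩ := hsurj (Pi.single (.inr a) 1) (by simp)
        have := hT0 X hX
        simp only [hXk, Pi.single_apply, mul_ite, mul_one, mul_zero, Finset.sum_ite_eq',
          Finset.mem_univ, if_true] at this
        rw [hNr, mul_zero]
        exact (mul_eq_zero.1 this).resolve_left (hs _))
    (fun i a => by rw [hpN, hpy])
  rw [main, hc, ← curvature_formula f l hc0]
  simp only [Fintype.sum_sum_type, hNl, hNr, hρ]
  norm_num

end AdaptedCoordinates

/-! ### Orthonormal coordinates of self-adjoint matrices. -/

section HermitianCoordinates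

variable {𝕜 : Type} [RCLike 𝕜] {n : ℕ} {κ : Type}

/-- The index set of the real coordinates of the entries above the diagonal. -/
abbrev OffDiag (n : ℕ) (κ : Type) : Type := (Σ i : Fin n, {j // j ∈ Finset.Ioi i}) × κ

/-- Orthonormal coordinates of the space of self-adjoint matrices, where `τ` are orthonormal real
coordinates of the field. -/
def hermCoord (τ : κ → 𝕜 →L[ℝ] ℝ) :
    Matrix (Fin n) (Fin n) 𝕜 →ₗ[ℝ] (Fin n ⊕ OffDiag n κ → ℝ) where
  toFun A := Sum.elim (fun i => RCLike.re (A i i)) fun a => √2 * τ a.2 (A a.1.1 a.1.2)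
  map_add' A B := by
    ext a
    rcases a with i | a <;> simp [mul_add]
  map_smul' r A := by
    ext a
    rcases a with i | a <;> simp [RCLike.smul_re, mul_left_comm]

@[simp]
theorem hermCoord_inl (τ : κ → 𝕜 →L[ℝ] ℝ) (A : Matrix (Fin n) (Fin n) 𝕜) (i : Fin n) :
    hermCoord τ A (.inl i) = RCLike.re (A i i) := rfl

@[simp]
theorem hermCoord_inr (τ : κ → 𝕜 →L[ℝ] ℝ) (A : Matrix (Fin n) (Fin n) 𝕜) (a : OffDiag n κ) :
    hermCoord τ A (.inr a) = √2 * τ a.2 (A a.1.1 a.1.2) := rfl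

variable [Fintype κ]

theorem sum_offDiag (F : Fin n → Fin n → κ → ℝ) :
    ∑ a : OffDiag n κ, F a.1.1 a.1.2 a.2 = ∑ i, ∑ j ∈ Finset.Ioi i, ∑ k, F i j k := by
  rw [Fintype.sum_prod_type, Fintype.sum_sigma]
  exact Finset.sum_congr rfl fun i _ =>
    Finset.sum_coe_sort (Finset.Ioi i) fun j => ∑ k, F i j k

/-- The entries `(i,j)` and `(j,i)` contribute equally to the trace; the factor `√2` in the
coordinates accounts for this doubling. -/
theorem traceMetric_eq_dotProduct_hermCoord {τ : κ → 𝕜 →L[ℝ] ℝ}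
    (hτ : ∀ x y : 𝕜, RCLike.re (x * star y) = ∑ k, τ k x * τ k y)
    {A B : Matrix (Fin n) (Fin n) 𝕜} (hA : A.IsHermitian) (hB : B.IsHermitian) :
    traceMetric A B = hermCoord τ A ⬝ᵥ hermCoord τ B := by
  have h1 : traceMetric A B = ∑ i, ∑ j, RCLike.re (A i j * star (B i j)) := by
    simp only [traceMetric, Matrix.trace, Matrix.diag, Matrix.mul_apply, map_sum, hB.apply]
  have h2 : ∀ i j, RCLike.re (A j i * star (B j i)) = RCLike.re (A i j * star (B i j)) := by
    intro i j
    rw [← hA.apply, ← hB.apply i j, star_star, ← RCLike.conj_re]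
    simp
  have h3 := Finset.sum_sum_Ioi_add_eq_sum_sum_off_diag
    fun i j : Fin n => RCLike.re (A i j * star (B i j))
  have h4 : ∀ i, RCLike.re (A i i * star (B i i)) = RCLike.re (A i i) * RCLike.re (B i i) := by
    intro i
    have h5 : RCLike.im (A i i) = 0 := RCLike.conj_eq_iff_im.1 (hA.apply i i)
    simp [RCLike.mul_re, h5]
  have h6 : ∑ a : OffDiag n κ, √2 * τ a.2 (A a.1.1 a.1.2) * (√2 * τ a.2 (B a.1.1 a.1.2))
      = ∑ i, ∑ j ∈ Finset.Ioi i, ∑ k, √2 * τ k (A i j) * (√2 * τ k (B i j)) :=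
    sum_offDiag fun i j k => √2 * τ k (A i j) * (√2 * τ k (B i j))
  have h7 : ∀ i j, ∑ k, √2 * τ k (A i j) * (√2 * τ k (B i j))
      = RCLike.re (A j i * star (B j i)) + RCLike.re (A i j * star (B i j)) := by
    intro i j
    rw [h2, hτ, ← two_mul, Finset.mul_sum]
    refine Finset.sum_congr rfl fun k _ => ?_
    have : √2 * √2 = (2 : ℝ) := Real.mul_self_sqrt (by norm_num)
    linear_combination τ k (A i j) * τ k (B i j) * this
  rw [dotProduct, Fintype.sum_sum_type]
  simp only [hermCoord_inl, hermCoord_inr]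
  rw [h6]
  simp only [h7]
  rw [h3, h1, ← Finset.sum_add_distrib]
  rw [Finset.sum_comm]
  refine Finset.sum_congr rfl fun i _ => ?_
  rw [← h4, Fintype.sum_eq_add_sum_compl i]

theorem eq_zero_of_hermCoord_eq_zero {τ : κ → 𝕜 →L[ℝ] ℝ}
    (hτ : ∀ x y : 𝕜, RCLike.re (x * star y) = ∑ k, τ k x * τ k y)
    {A : Matrix (Fin n) (Fin n) 𝕜} (hA : A.IsHermitian) (h : hermCoord τ A = 0) : A = 0 := by
  have h1 : ∑ i, ∑ j, RCLike.re (A i j * star (A i j)) = 0 := by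
    have h2 := traceMetric_eq_dotProduct_hermCoord hτ hA hA
    rw [h, zero_dotProduct] at h2
    rw [← h2]
    simp only [traceMetric, Matrix.trace, Matrix.diag, Matrix.mul_apply, map_sum, hA.apply]
  have h3 : ∀ x : 𝕜, RCLike.re (x * star x) = ‖x‖ ^ 2 := by
    intro x
    rw [RCLike.star_def, RCLike.mul_conj]
    norm_cast
  simp only [h3] at h1
  ext i j
  have h4 := (Finset.sum_eq_zero_iff_of_nonneg fun i _ =>
    Finset.sum_nonneg fun j _ => sq_nonneg ‖A i j‖).1 h1 i (Finset.mem_univ i)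
  have h5 := (Finset.sum_eq_zero_iff_of_nonneg fun j _ => sq_nonneg ‖A i j‖).1 h4 j
    (Finset.mem_univ j)
  simpa using h5

theorem exists_hermCoord_eq {τ : κ → 𝕜 →L[ℝ] ℝ} [DecidableEq κ] (e : κ → 𝕜)
    (he : ∀ k l, τ k (e l) = if k = l then 1 else 0) (w : Fin n ⊕ OffDiag n κ → ℝ) :
    ∃ A : Matrix (Fin n) (Fin n) 𝕜, A.IsHermitian ∧ hermCoord τ A = w ∧
      A.trace = ((∑ i, w (.inl i) : ℝ) : 𝕜) := by
  -- `B` is the strictly upper triangular part with the factor `√2` undone; adding its adjoint makes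
  -- the matrix Hermitian without disturbing the entries above the diagonal.
  set B : Fin n → Fin n → 𝕜 := fun i j =>
    if h : i < j then ∑ k, ((√2)⁻¹ * w (.inr (⟨i, j, Finset.mem_Ioi.2 h⟩, k))) • e k else 0 with hB
  refine ⟨Matrix.of fun i j => if i = j then (w (.inl i) : 𝕜) else B i j + star (B j i), ?_, ?_, ?_⟩
  · ext i j
    rw [Matrix.conjTranspose_apply, Matrix.of_apply, Matrix.of_apply]
    by_cases h : i = j
    · subst h
      simp
    · rw [if_neg h, if_neg (Ne.symm h), star_add, star_star, add_comm]
  · ext a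
    rcases a with i | ⟨⟨i, j, hj⟩, k⟩
    · simp
    · have hij : i < j := Finset.mem_Ioi.1 hj
      simp only [hermCoord_inr, Matrix.of_apply, hij.ne, if_false, hB, hij, hij.not_gt, dif_pos,
        dif_neg, not_false_eq_true, star_zero, add_zero, map_sum, map_smul, he, smul_eq_mul,
        mul_ite, mul_one, mul_zero, Finset.sum_ite_eq, Finset.mem_univ, if_true]
      rw [← mul_assoc, mul_inv_cancel₀ (by positivity), one_mul]
  · simp [Matrix.trace]

end HermitianCoordinates

end

noncomputable section

/-! ### The state space as a hypersurface with normal field `(1/f')(D)`. -/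

section Quantum

open Set

variable {𝕜 : Type} [RCLike 𝕜] {n : ℕ}

/-- The derivative at `A` in the direction `X` of the functional calculus of `f`. -/
def cfcDeriv (f : ℝ → ℝ) (A X : Matrix (Fin n) (Fin n) 𝕜) : Matrix (Fin n) (Fin n) 𝕜 :=
  Matrix.of fun s t => deriv (fun r : ℝ => cfc f (A + r • X) s t) 0

theorem hasDerivAt_inEigenbasis {D L : Matrix (Fin n) (Fin n) 𝕜} (hD : D.IsHermitian)
    {M : ℝ → Matrix (Fin n) (Fin n) 𝕜} (hM : ∀ s t, HasDerivAt (fun r => M r s t) (L s t) 0)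
    (i j : Fin n) : HasDerivAt (fun r => inEigenbasis hD (M r) i j) (inEigenbasis hD L i j) 0 := by
  simp only [inEigenbasis_apply]
  exact HasDerivAt.fun_sum fun l _ => HasDerivAt.fun_sum fun k _ =>
    ((hM k l).const_mul _).mul_const _

section

variable {f : ℝ → ℝ} (hf : HasHolomorphicExtension f) {A X Y : Matrix (Fin n) (Fin n) 𝕜}
  (hA : A.IsHermitian) (h0 : ∀ i, hA.eigenvalues i ∈ Ioo (0 : ℝ) 1) (hX : X.IsHermitian)
  (hY : Y.IsHermitian)

include hf h0 hX

theorem hasDerivAt_cfcDeriv (s t : Fin n) :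
    HasDerivAt (fun r : ℝ => cfc f (A + r • X) s t) (cfcDeriv f A X s t) 0 :=
  (differentiableAt_cfc_add_smul_apply hf hA h0 hX s t).hasDerivAt

theorem isHermitian_cfcDeriv : (cfcDeriv f A X).IsHermitian := by
  ext s t
  rw [Matrix.conjTranspose_apply]
  refine HasDerivAt.unique ?_ (hasDerivAt_cfcDeriv hf hA h0 hX s t)
  refine (hasDerivAt_cfcDeriv hf hA h0 hX t s).star.congr_of_eventuallyEq (.of_forall fun r => ?_)
  exact ((isHermitian_cfc f (A + r • X)).apply s t).symm

theorem inEigenbasis_cfcDeriv (i j : Fin n) :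
    inEigenbasis hA (cfcDeriv f A X) i j
      = dslope f (hA.eigenvalues i) (hA.eigenvalues j) • inEigenbasis hA X i j :=
  (hasDerivAt_inEigenbasis hA (hasDerivAt_cfcDeriv hf hA h0 hX) i j).unique
    (hasDerivAt_inEigenbasis_cfc hf hA h0 hX i j)

theorem dirDeriv_cfc :
    dirDeriv (fun B : Matrix (Fin n) (Fin n) 𝕜 => cfc f B) A X = cfcDeriv f A X := by
  have h : HasDerivAt (fun (r : ℝ) (s t : Fin n) => cfc f (A + r • X) s t)
      (fun s t => cfcDeriv f A X s t) 0 :=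
    hasDerivAt_pi.2 fun s => hasDerivAt_pi.2 fun t => hasDerivAt_cfcDeriv hf hA h0 hX s t
  exact h.deriv

include hY in
theorem gf_eq_traceMetric :
    gf f A X Y = traceMetric (cfcDeriv f A X) (cfcDeriv f A Y) := by
  rw [gf, pullbackMetric, dirDeriv_cfc hf hA h0 hX, dirDeriv_cfc hf hA h0 hY]

/-- Only diagonal entries in the eigenbasis of `A` matter, and there the divided difference of `f`
is `f'(λᵢ)`, which `1/f'` cancels. For trace-free `X` this says that `(1/f')(A)` is normal. -/
theorem traceMetric_cfcDeriv_cfc_inv_deriv (hf' : ∀ x ∈ Ioo (0 : ℝ) 1, deriv f x ≠ 0) :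
    traceMetric (cfcDeriv f A X) (cfc (fun x => (deriv f x)⁻¹) A) = RCLike.re X.trace := by
  rw [traceMetric, ← trace_inEigenbasis hA, inEigenbasis_mul, inEigenbasis_cfc,
    ← trace_inEigenbasis hA X]
  congr 1
  refine Finset.sum_congr rfl fun i _ => ?_
  have h1 : ((deriv f (hA.eigenvalues i) : ℝ) : 𝕜) ≠ 0 := by exact_mod_cast hf' _ (h0 i)
  rw [Matrix.diag_apply, Matrix.mul_diagonal, inEigenbasis_cfcDeriv hf hA h0 hX, dslope_same,
    RCLike.real_smul_eq_coe_mul, Matrix.diag_apply, RCLike.ofReal_inv]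
  field_simp

end

theorem traceMetric_inEigenbasis {D : Matrix (Fin n) (Fin n) 𝕜} (hD : D.IsHermitian)
    (A B : Matrix (Fin n) (Fin n) 𝕜) :
    traceMetric (inEigenbasis hD A) (inEigenbasis hD B) = traceMetric A B := by
  rw [traceMetric, ← inEigenbasis_mul, trace_inEigenbasis, traceMetric]

theorem ofEigenbasis_inEigenbasis {D : Matrix (Fin n) (Fin n) 𝕜} (hD : D.IsHermitian)
    (A : Matrix (Fin n) (Fin n) 𝕜) :
    (hD.eigenvectorUnitary : Matrix (Fin n) (Fin n) 𝕜) * inEigenbasis hD A *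
      star (hD.eigenvectorUnitary : Matrix (Fin n) (Fin n) 𝕜) = A := by
  have hVV : (hD.eigenvectorUnitary : Matrix (Fin n) (Fin n) 𝕜) *
      star (hD.eigenvectorUnitary : Matrix (Fin n) (Fin n) 𝕜) = 1 :=
    Unitary.mul_star_self_of_mem hD.eigenvectorUnitary.2
  simp only [inEigenbasis, ← Matrix.mul_assoc]
  rw [hVV, Matrix.one_mul, Matrix.mul_assoc, hVV, Matrix.mul_one]

theorem inEigenbasis_ofEigenbasis {D : Matrix (Fin n) (Fin n) 𝕜} (hD : D.IsHermitian)
    (A : Matrix (Fin n) (Fin n) 𝕜) :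
    inEigenbasis hD ((hD.eigenvectorUnitary : Matrix (Fin n) (Fin n) 𝕜) * A *
      star (hD.eigenvectorUnitary : Matrix (Fin n) (Fin n) 𝕜)) = A := by
  have hVV' : star (hD.eigenvectorUnitary : Matrix (Fin n) (Fin n) 𝕜) * hD.eigenvectorUnitary = 1 :=
    Unitary.star_mul_self_of_mem hD.eigenvectorUnitary.2
  simp only [inEigenbasis, ← Matrix.mul_assoc]
  rw [hVV', Matrix.one_mul, Matrix.mul_assoc, hVV', Matrix.mul_one]

variable {κ : Type}

/-- Orthonormal coordinates of the space of self-adjoint matrices in an eigenbasis of `D`. -/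
def eigenCoord (τ : κ → 𝕜 →L[ℝ] ℝ) {D : Matrix (Fin n) (Fin n) 𝕜} (hD : D.IsHermitian) :
    Matrix (Fin n) (Fin n) 𝕜 →ₗ[ℝ] (Fin n ⊕ OffDiag n κ → ℝ) where
  toFun A := hermCoord τ (inEigenbasis hD A)
  map_add' A B := by rw [inEigenbasis_add, map_add]
  map_smul' r A := by rw [inEigenbasis_smul, map_smul, RingHom.id_apply]

theorem eigenCoord_apply (τ : κ → 𝕜 →L[ℝ] ℝ) {D : Matrix (Fin n) (Fin n) 𝕜} (hD : D.IsHermitian)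
    (A : Matrix (Fin n) (Fin n) 𝕜) : eigenCoord τ hD A = hermCoord τ (inEigenbasis hD A) := rfl

theorem hasDerivAt_eigenCoord (τ : κ → 𝕜 →L[ℝ] ℝ) {D L : Matrix (Fin n) (Fin n) 𝕜}
    (hD : D.IsHermitian) {M : ℝ → Matrix (Fin n) (Fin n) 𝕜}
    (hM : ∀ s t, HasDerivAt (fun r => M r s t) (L s t) 0) (a : Fin n ⊕ OffDiag n κ) :
    HasDerivAt (fun r => eigenCoord τ hD (M r) a) (eigenCoord τ hD L a) 0 := by
  have h := hasDerivAt_inEigenbasis hD hM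
  rcases a with i | a
  · exact (RCLike.reCLM (K := 𝕜)).hasFDerivAt.comp_hasDerivAt (0 : ℝ) (h i i)
  · exact ((τ a.2).hasFDerivAt.comp_hasDerivAt (0 : ℝ) (h a.1.1 a.1.2)).const_mul √2

theorem contDiffAt_eigenCoord (τ : κ → 𝕜 →L[ℝ] ℝ) {D : Matrix (Fin n) (Fin n) 𝕜}
    (hD : D.IsHermitian) {d : ℕ} {M : (Fin d → ℝ) → Matrix (Fin n) (Fin n) 𝕜} {x : Fin d → ℝ}
    {N : WithTop ℕ∞} (hM : ∀ s t, ContDiffAt ℝ N (fun r => M r s t) x)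
    (a : Fin n ⊕ OffDiag n κ) : ContDiffAt ℝ N (fun r => eigenCoord τ hD (M r) a) x := by
  have h : ∀ i j, ContDiffAt ℝ N (fun r => inEigenbasis hD (M r) i j) x := by
    intro i j
    simp only [inEigenbasis_apply]
    exact ContDiffAt.sum fun l _ => ContDiffAt.sum fun k _ =>
      (contDiffAt_const.mul (hM k l)).mul contDiffAt_const
  rcases a with i | a
  · exact (RCLike.reCLM (K := 𝕜)).contDiff.contDiffAt.comp x (h i i)
  · exact contDiffAt_const.mul ((τ a.2).contDiff.contDiffAt.comp x (h a.1.1 a.1.2))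

theorem contDiff_affineChart_apply {T : Submodule ℝ (Matrix (Fin n) (Fin n) 𝕜)} {d : ℕ}
    (b : Module.Basis (Fin d) ℝ T) (D : Matrix (Fin n) (Fin n) 𝕜) {N : WithTop ℕ∞} (s t : Fin n) :
    ContDiff ℝ N fun x => affineChart b D x s t := by
  simp only [affineChart, Matrix.add_apply, Matrix.sum_apply, Matrix.smul_apply]
  fun_prop

theorem isHermitian_affineChart {T : Submodule ℝ (Matrix (Fin n) (Fin n) 𝕜)} {d : ℕ}
    (b : Module.Basis (Fin d) ℝ T) (hT : ∀ X ∈ T, X.IsHermitian) {D : Matrix (Fin n) (Fin n) 𝕜}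
    (hD : D.IsHermitian) (x : Fin d → ℝ) : (affineChart b D x).IsHermitian := by
  have h : ∀ i, (x i • (b i : Matrix (Fin n) (Fin n) 𝕜)).IsHermitian := fun i =>
    hT _ (T.smul_mem _ (b i).2)
  refine hD.add ?_
  unfold Matrix.IsHermitian
  rw [Matrix.conjTranspose_sum]
  exact Finset.sum_congr rfl fun i _ => h i

/-- Rolle's theorem. Injectivity keeps the denominators in `rho` and the off-diagonal divided
differences of `f` away from zero. -/
theorem eq_of_apply_eq_of_deriv_ne_zero {f : ℝ → ℝ} (hf : HasHolomorphicExtension f)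
    (hf' : ∀ x ∈ Ioo (0 : ℝ) 1, deriv f x ≠ 0) {x y : ℝ} (hx : x ∈ Ioo (0 : ℝ) 1)
    (hy : y ∈ Ioo (0 : ℝ) 1) (h : f x = f y) : x = y := by
  have key : ∀ x y : ℝ, x ∈ Ioo (0 : ℝ) 1 → y ∈ Ioo (0 : ℝ) 1 → f x = f y → ¬ x < y := by
    intro x y hx hy h hlt
    obtain ⟨c, hc, hc'⟩ := exists_deriv_eq_zero hlt (fun z hz =>
      (hf.contDiffAt (N := 0) ⟨hx.1.trans_le hz.1, hz.2.trans_lt hy.2⟩).continuousAt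
        |>.continuousWithinAt) h
    exact hf' c ⟨hx.1.trans hc.1, hc.2.trans hy.2⟩ hc'
  exact le_antisymm (not_lt.1 (key y x hy hx h.symm)) (not_lt.1 (key x y hx hy h))

theorem dslope_ne_zero {f : ℝ → ℝ} (hf : HasHolomorphicExtension f)
    (hf' : ∀ x ∈ Ioo (0 : ℝ) 1, deriv f x ≠ 0) {x y : ℝ} (hx : x ∈ Ioo (0 : ℝ) 1)
    (hy : y ∈ Ioo (0 : ℝ) 1) : dslope f x y ≠ 0 := by
  by_cases h : y = x
  · subst h
    rw [dslope_same]
    exact hf' y hy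
  · rw [dslope_of_ne _ h, slope_def_field]
    exact div_ne_zero (sub_ne_zero.2 fun h' => h (eq_of_apply_eq_of_deriv_ne_zero hf hf' hy hx h'))
      (sub_ne_zero.2 h)

/-- This is the origin of `rho`: it is the factor by which the derivative of the normal field
differs from that of the immersion, in each matrix entry. -/
theorem dslope_inv_deriv {f : ℝ → ℝ} (hf : HasHolomorphicExtension f)
    (hf' : ∀ x ∈ Ioo (0 : ℝ) 1, deriv f x ≠ 0) {x y : ℝ} (hx : x ∈ Ioo (0 : ℝ) 1)
    (hy : y ∈ Ioo (0 : ℝ) 1) :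
    dslope (fun t => (deriv f t)⁻¹) x y = rho f x y * dslope f x y := by
  have hfx := hf' x hx
  have hfy := hf' y hy
  by_cases h : x = y
  · subst h
    have hd : DifferentiableAt ℝ (deriv f) x :=
      ((hf.contDiffAt (N := 2) hx).deriv_of_add_one_le (m := 1) (by norm_num)).differentiableAt
        (by norm_num)
    rw [dslope_same, dslope_same, deriv_fun_inv'' hd hfx, rho, if_pos rfl]
    field_simp
  · have h1 : f x - f y ≠ 0 :=
      sub_ne_zero.2 fun h' => h (eq_of_apply_eq_of_deriv_ne_zero hf hf' hx hy h')
    have h2 : y - x ≠ 0 := sub_ne_zero.2 (Ne.symm h)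
    rw [dslope_of_ne _ (Ne.symm h), dslope_of_ne _ (Ne.symm h), slope_def_field, slope_def_field,
      rho, if_neg h]
    field_simp
    ring

/-- The scalar curvature of the state space, where `τ` are orthonormal real coordinates of the
field and `e` is the dual basis. -/
theorem scalarCurvature_gf_stateTangent [NeZero n] [Fintype κ] [DecidableEq κ]
    {τ : κ → 𝕜 →L[ℝ] ℝ} (hτ : ∀ x y : 𝕜, RCLike.re (x * star y) = ∑ k, τ k x * τ k y)
    {e : κ → 𝕜} (he : ∀ k l, τ k (e l) = if k = l then 1 else 0)
    {f : ℝ → ℝ} (hf : HasHolomorphicExtension f) (hf' : ∀ x ∈ Ioo (0 : ℝ) 1, deriv f x ≠ 0)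
    {D : Matrix (Fin n) (Fin n) 𝕜} (hD : D.IsHermitian)
    (h0 : ∀ i, hD.eigenvalues i ∈ Ioo (0 : ℝ) 1) {d : ℕ}
    (b : Module.Basis (Fin d) ℝ (stateTangent 𝕜 n)) :
    scalarCurvature b (gf f) D =
      4 / cNorm f hD.eigenvalues ^ 4 * (diagDoubleSum f hD.eigenvalues
          - diagSum f hD.eigenvalues * (Fintype.card κ * rhoSum f hD.eigenvalues))
        + (Fintype.card κ * rhoSum f hD.eigenvalues) ^ 2 / cNorm f hD.eigenvalues ^ 2
        - (Fintype.card κ * rhoSqSum f hD.eigenvalues) / cNorm f hD.eigenvalues ^ 2 := by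
  set l := hD.eigenvalues with hl
  have hbH : ∀ i, (b i : Matrix (Fin n) (Fin n) 𝕜).IsHermitian := fun i => (b i).2.1
  have hH : ∀ x, (affineChart b D x).IsHermitian :=
    isHermitian_affineChart b (fun X hX => hX.1) hD
  have hev : ∀ᶠ x in 𝓝 (0 : Fin d → ℝ), ∀ i, (hH x).eigenvalues i ∈ Ioo (0 : ℝ) 1 :=
    eventually_eigenvalues_mem
      (continuous_matrix fun s t => (contDiff_affineChart_apply (N := 0) b D s t).continuous).continuousAt
      hH isOpen_Ioo (by simpa using h0)
  -- Stated for a general function because it is needed for the immersion (`f`) and for the normal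
  -- field (`1/f'`). The eigenbasis is that of the fixed state `D`, so the coordinates stay linear.
  have hsm : ∀ {h : ℝ → ℝ}, HasHolomorphicExtension h → ∀ᶠ x in 𝓝 (0 : Fin d → ℝ),
      ContDiffAt ℝ 3 (fun x => eigenCoord τ hD (cfc h (affineChart b D x))) x := by
    intro h hh
    filter_upwards [hev] with x hx
    exact contDiffAt_pi.2 fun a => contDiffAt_eigenCoord τ hD (fun s t =>
      contDiffAt_cfc_apply hh 3 (contDiff_affineChart_apply b D) hH hx s t) a
  have hpd : ∀ {h : ℝ → ℝ}, HasHolomorphicExtension h → ∀ᶠ x in 𝓝 (0 : Fin d → ℝ), ∀ i,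
      pderiv i (fun x => eigenCoord τ hD (cfc h (affineChart b D x))) x
        = eigenCoord τ hD (cfcDeriv h (affineChart b D x) (b i)) := by
    intro h hh
    filter_upwards [hev, hsm hh] with x hx hx' i
    have h1 := (hx'.differentiableAt (by norm_num)).lineDeriv_eq_fderiv (v := Pi.single i 1)
    rw [pderiv, ← h1]
    have h2 : HasDerivAt (fun r : ℝ => eigenCoord τ hD
        (cfc h (affineChart b D x + r • (b i : Matrix (Fin n) (Fin n) 𝕜))))
        (eigenCoord τ hD (cfcDeriv h (affineChart b D x) (b i))) 0 :=
      hasDerivAt_pi.2 fun a => hasDerivAt_eigenCoord τ hD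
        (hasDerivAt_cfcDeriv hh (hH x) hx (hbH i)) a
    rw [lineDeriv]
    simp only [affineChart_add_single]
    exact h2.deriv
  have hpd0 : ∀ {h : ℝ → ℝ}, HasHolomorphicExtension h → ∀ i,
      pderiv i (fun x => eigenCoord τ hD (cfc h (affineChart b D x))) 0
        = eigenCoord τ hD (cfcDeriv h D (b i)) := by
    intro h hh i
    simpa using (hpd hh).self_of_nhds i
  have hmetric : ∀ {A B : Matrix (Fin n) (Fin n) 𝕜}, A.IsHermitian → B.IsHermitian →
      eigenCoord τ hD A ⬝ᵥ eigenCoord τ hD B = traceMetric A B := by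
    intro A B hA hB
    rw [eigenCoord_apply, eigenCoord_apply, ← traceMetric_eq_dotProduct_hermCoord hτ
      (isHermitian_inEigenbasis hD hA) (isHermitian_inEigenbasis hD hB), traceMetric_inEigenbasis]
  have hinv := hf.inv_deriv hf'
  have main := scalarCurvature_of_diagonal_derivatives (b := b) (g := gf f) (p := D) (f := f)
    (l := l) (fun k => hf' _ (h0 k))
    (y := fun x => eigenCoord τ hD (cfc f (affineChart b D x)))
    (N := fun x => eigenCoord τ hD (cfc (fun t => (deriv f t)⁻¹) (affineChart b D x)))
    (hsm hf).self_of_nhds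
    (by
      filter_upwards [hev, hpd hf] with x hx hx' i j
      rw [hx', hx', hmetric (isHermitian_cfcDeriv hf (hH x) hx (hbH i))
        (isHermitian_cfcDeriv hf (hH x) hx (hbH j)), gf_eq_traceMetric hf (hH x) hx (hbH i) (hbH j)])
    ((hsm hinv).self_of_nhds.differentiableAt (by norm_num))
    (by
      filter_upwards [hev, hpd hf] with x hx hx' i
      rw [hx', hmetric (isHermitian_cfcDeriv hf (hH x) hx (hbH i)) (isHermitian_cfc _ _),
        traceMetric_cfcDeriv_cfc_inv_deriv hf (hH x) hx (hbH i) hf', (b i).2.2, map_zero])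
    (eigenCoord τ hD)
    (s := Sum.elim (fun k => deriv f (l k)) fun a => dslope f (l a.1.1) (l a.1.2))
    (ρ := Sum.elim (fun k => -(deriv (deriv f) (l k) / deriv f (l k) ^ 3))
      fun a => rho f (l a.1.1) (l a.1.2))
    (by
      rintro (k | a)
      · exact hf' _ (h0 k)
      · exact dslope_ne_zero hf hf' (h0 _) (h0 _))
    (fun k => rfl) (fun k => rfl)
    (by
      rintro i (k | a)
      · rw [hpd0 hf, eigenCoord_apply, eigenCoord_apply, hermCoord_inl, hermCoord_inl,
          inEigenbasis_cfcDeriv hf hD h0 (hbH i), dslope_same, RCLike.smul_re]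
        rfl
      · rw [hpd0 hf, eigenCoord_apply, eigenCoord_apply, hermCoord_inr, hermCoord_inr,
          inEigenbasis_cfcDeriv hf hD h0 (hbH i), map_smul, smul_eq_mul, mul_left_comm]
        rfl)
    (by
      rintro i (k | a)
      · have h1 := dslope_inv_deriv hf hf' (h0 k) (h0 k)
        rw [rho, if_pos rfl, dslope_same (f := f)] at h1
        rw [hpd0 hinv, eigenCoord_apply, eigenCoord_apply, hermCoord_inl, hermCoord_inl,
          inEigenbasis_cfcDeriv hinv hD h0 (hbH i), h1, RCLike.smul_re, mul_assoc]
        rfl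
      · rw [hpd0 hinv, eigenCoord_apply, eigenCoord_apply, hermCoord_inr, hermCoord_inr,
          inEigenbasis_cfcDeriv hinv hD h0 (hbH i), dslope_inv_deriv hf hf' (h0 _) (h0 _), map_smul,
          smul_eq_mul, mul_left_comm, mul_assoc]
        rfl)
    (by
      intro k
      rw [affineChart_zero, eigenCoord_apply, inEigenbasis_cfc, hermCoord_inl,
        Matrix.diagonal_apply_eq, RCLike.ofReal_re])
    (by
      rintro ⟨⟨i, j, hj⟩, k⟩
      have hij : i ≠ j := (Finset.mem_Ioi.1 hj).ne
      rw [affineChart_zero, eigenCoord_apply, inEigenbasis_cfc, hermCoord_inr]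
      simp [Matrix.diagonal_apply_ne _ hij])
    (by
      intro X hX hX0
      have h1 := eq_zero_of_hermCoord_eq_zero hτ (isHermitian_inEigenbasis hD hX.1) hX0
      rw [← ofEigenbasis_inEigenbasis hD X, h1, Matrix.mul_zero, Matrix.zero_mul])
    (by
      intro w hw
      obtain ⟨B, hB, hBw, hBt⟩ := exists_hermCoord_eq e he w
      rw [hw, RCLike.ofReal_zero] at hBt
      refine ⟨_, ⟨?_, ?_⟩, (congrArg (hermCoord τ) (inEigenbasis_ofEigenbasis hD B)).trans hBw⟩
      · rw [Matrix.star_eq_conjTranspose]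
        exact Matrix.isHermitian_mul_mul_conjTranspose _ hB
      · rw [← trace_inEigenbasis hD, inEigenbasis_ofEigenbasis, hBt])
  rw [main]
  simp only [Sum.elim_inr]
  -- `ρᵢⱼ` is the same for all real coordinates of one entry, so summation over them produces the
  -- factor `Fintype.card κ`.
  rw [sum_offDiag (fun i j _ => rho f (l i) (l j)), sum_offDiag (fun i j _ => rho f (l i) (l j) ^ 2)]
  simp only [Finset.sum_const, Finset.card_univ, nsmul_eq_mul, ← Finset.mul_sum]
  rfl

end Quantum

end

noncomputable section

/-! ### Eigenvalue range, the case of a single point, and diagonal states. -/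

section Main

open Set

open scoped ComplexOrder

theorem Admissible.hasHolomorphicExtension {f : ℝ → ℝ} (hf : Admissible f) :
    HasHolomorphicExtension f := hf.1

variable {𝕜 : Type} [RCLike 𝕜] {n : ℕ}

theorem ne_zero_of_mem_stateSpace {D : Matrix (Fin n) (Fin n) 𝕜} (hD : D ∈ stateSpace 𝕜 n) :
    n ≠ 0 := by
  rintro rfl
  simpa [Matrix.trace] using hD.2

theorem lt_one_of_sum_eq_one {l : Fin n → ℝ} (hn : 2 ≤ n) (hpos : ∀ i, 0 < l i)
    (hsum : ∑ i, l i = 1) (i : Fin n) : l i < 1 := by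
  have : Nontrivial (Fin n) := Fin.nontrivial_iff_two_le.2 hn
  obtain ⟨j, hj⟩ := exists_ne i
  rw [← hsum]
  exact Finset.single_lt_sum hj (Finset.mem_univ i) (Finset.mem_univ j) (hpos j)
    fun k _ _ => (hpos k).le

theorem eigenvalues_mem_Ioo {D : Matrix (Fin n) (Fin n) 𝕜} (hD : D ∈ stateSpace 𝕜 n) (hn : 2 ≤ n)
    (i : Fin n) : (stateSpace.isHermitian hD).eigenvalues i ∈ Ioo (0 : ℝ) 1 := by
  have hpos := hD.1.eigenvalues_pos
  refine ⟨hpos i, lt_one_of_sum_eq_one hn hpos ?_ i⟩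
  have h := (stateSpace.isHermitian hD).trace_eq_sum_eigenvalues
  rw [hD.2] at h
  exact_mod_cast h.symm

theorem scalarCurvature_of_subsingleton {E : Type*} [AddCommGroup E] [Module ℝ E]
    {T : Submodule ℝ E} [Subsingleton T] {d : ℕ} (b : Module.Basis (Fin d) ℝ T)
    (g : E → E → E → ℝ) (p : E) : scalarCurvature b g p = 0 := by
  have : IsEmpty (Fin d) := ⟨fun i => b.ne_zero i (Subsingleton.elim _ _)⟩
  simp [scalarCurvature]

theorem diagDoubleSum_one (f : ℝ → ℝ) (l : Fin 1 → ℝ) : diagDoubleSum f l = 0 := by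
  simp [diagDoubleSum]

theorem rhoSum_one (f : ℝ → ℝ) (l : Fin 1 → ℝ) : rhoSum f l = 0 := by
  simp [rhoSum]

theorem rhoSqSum_one (f : ℝ → ℝ) (l : Fin 1 → ℝ) : rhoSqSum f l = 0 := by
  simp [rhoSqSum]

theorem subsingleton_stateTangent_one : Subsingleton (stateTangent 𝕜 1) := by
  refine ⟨fun X Y => Subtype.ext ?_⟩
  have hX : (X : Matrix (Fin 1) (Fin 1) 𝕜).trace = 0 := X.2.2
  have hY : (Y : Matrix (Fin 1) (Fin 1) 𝕜).trace = 0 := Y.2.2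
  rw [Matrix.trace_fin_one] at hX hY
  ext i j
  rw [Subsingleton.elim i 0, Subsingleton.elim j 0, hX, hY]

theorem subsingleton_diagTangent_one : Subsingleton (diagTangent 𝕜 1) := by
  have := subsingleton_stateTangent_one (𝕜 := 𝕜)
  refine ⟨fun X Y => Subtype.ext ?_⟩
  have h : (⟨X.1, X.2.1⟩ : stateTangent 𝕜 1) = ⟨Y.1, Y.2.1⟩ := Subsingleton.elim _ _
  exact congrArg (fun Z : stateTangent 𝕜 1 => (Z : Matrix (Fin 1) (Fin 1) 𝕜)) h

theorem scalarCurvature_stateSpace {κ : Type} [Fintype κ] [DecidableEq κ]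
    {τ : κ → 𝕜 →L[ℝ] ℝ} (hτ : ∀ x y : 𝕜, RCLike.re (x * star y) = ∑ k, τ k x * τ k y)
    {e : κ → 𝕜} (he : ∀ k l, τ k (e l) = if k = l then 1 else 0)
    {f : ℝ → ℝ} (hf : Admissible f) {D : Matrix (Fin n) (Fin n) 𝕜} (hD : D ∈ stateSpace 𝕜 n)
    {d : ℕ} (b : Module.Basis (Fin d) ℝ (stateTangent 𝕜 n)) {l : Fin n → ℝ}
    (hl : l = (stateSpace.isHermitian hD).eigenvalues) :
    scalarCurvature b (gf f) D =
      4 / cNorm f l ^ 4 * (diagDoubleSum f l - diagSum f l * (Fintype.card κ * rhoSum f l))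
        + (Fintype.card κ * rhoSum f l) ^ 2 / cNorm f l ^ 2
        - (Fintype.card κ * rhoSqSum f l) / cNorm f l ^ 2 := by
  have hn := ne_zero_of_mem_stateSpace hD
  have : NeZero n := ⟨hn⟩
  -- A one-point state has eigenvalue `1`, where `f` is arbitrary. Both sides vanish: there are no
  -- coordinates, and the sums over distinct indices are empty.
  by_cases hn1 : n = 1
  · subst hn1
    have := subsingleton_stateTangent_one (𝕜 := 𝕜)
    simp [scalarCurvature_of_subsingleton, diagDoubleSum_one, rhoSum_one, rhoSqSum_one]
  · rw [hl]
    exact scalarCurvature_gf_stateTangent hτ he hf.hasHolomorphicExtension hf.2 (stateSpace.isHermitian hD)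
      (eigenvalues_mem_Ioo hD (by omega)) b

/-- Expanding at `c = vᵢ`, the `i`-th row of `diag(v) - vᵢ` is zero, so that row of the result is
the one of the scalar matrix `f(vᵢ)`. -/
theorem cfc_diagonal_apply (f : ℝ → ℝ) (v : Fin n → ℝ) :
    cfc f (Matrix.diagonal v) = Matrix.diagonal fun k => f (v k) := by
  ext i j
  have h : Matrix.diagonal v - algebraMap ℝ _ (v i) = Matrix.diagonal fun k => v k - v i := by
    rw [Algebra.algebraMap_eq_smul_one, Matrix.smul_one_eq_diagonal, Matrix.diagonal_sub]
  rw [cfc_eq_add_mul_cfc_dslope (Matrix.isHermitian_diagonal v) f (v i), h, Matrix.add_apply,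
    Matrix.diagonal_mul, sub_self, zero_mul, add_zero, Algebra.algebraMap_eq_smul_one,
    Matrix.smul_one_eq_diagonal, Matrix.diagonal_apply, Matrix.diagonal_apply]

/-- Diagonal directions keep the state diagonal, where the functional calculus acts entrywise;
ordinary differentiability of `f` at the entries suffices. -/
theorem gf_eq_of_isDiag {f : ℝ → ℝ} {D X Y : Matrix (Fin n) (Fin n) ℝ} (hD : D.IsDiag)
    (hX : X.IsDiag) (hY : Y.IsDiag) (hf : ∀ k, DifferentiableAt ℝ f (D k k)) :
    gf f D X Y = ∑ k, (deriv f (D k k) * X k k) * (deriv f (D k k) * Y k k) := by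
  have h : ∀ Z : Matrix (Fin n) (Fin n) ℝ, Z.IsDiag →
      dirDeriv (fun B : Matrix (Fin n) (Fin n) ℝ => cfc f B) D Z
        = Matrix.diagonal fun k => deriv f (D k k) * Z k k := by
    intro Z hZ
    have hcfc : ∀ r : ℝ, cfc f (D + r • Z) = Matrix.diagonal fun k => f (D k k + r * Z k k) := by
      intro r
      rw [← cfc_diagonal_apply f fun k => D k k + r * Z k k]
      congr 1
      exact ((hD.add (hZ.smul r)).diagonal_diag).symm
    have h1 : HasDerivAt (fun (r : ℝ) (s t : Fin n) => cfc f (D + r • Z) s t)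
        (fun s t => Matrix.diagonal (fun k => deriv f (D k k) * Z k k) s t) 0 := by
      refine hasDerivAt_pi.2 fun s => hasDerivAt_pi.2 fun t => ?_
      simp only [hcfc]
      by_cases hst : s = t
      · subst hst
        simp only [Matrix.diagonal_apply_eq]
        have h2 : HasDerivAt (fun r : ℝ => D s s + r * Z s s) (Z s s) 0 := by
          simpa using ((hasDerivAt_id (0 : ℝ)).mul_const (Z s s)).const_add (D s s)
        have h3 : HasDerivAt f (deriv f (D s s)) (D s s + 0 * Z s s) := by
          simpa using (hf s).hasDerivAt
        exact h3.comp (0 : ℝ) h2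
      · simp only [Matrix.diagonal_apply_ne _ hst]
        exact hasDerivAt_const _ _
    exact h1.deriv
  rw [gf, pullbackMetric, h X hX, h Y hY, traceMetric, Matrix.diagonal_mul_diagonal,
    Matrix.trace_diagonal]
  rfl

theorem scalarCurvature_diagTangent {f : ℝ → ℝ} (hf : Admissible f)
    {D : Matrix (Fin n) (Fin n) ℝ} (hD : D ∈ stateSpace ℝ n) (hdiag : D.IsDiag)
    {d : ℕ} (b : Module.Basis (Fin d) ℝ (diagTangent ℝ n)) :
    scalarCurvature b (gf f) D = 4 / cNorm f D.diag ^ 4 * diagDoubleSum f D.diag := by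
  have hn := ne_zero_of_mem_stateSpace hD
  have : NeZero n := ⟨hn⟩
  by_cases hn1 : n = 1
  · subst hn1
    have := subsingleton_diagTangent_one (𝕜 := ℝ)
    simp [scalarCurvature_of_subsingleton, diagDoubleSum_one]
  have hIoo : ∀ k, D k k ∈ Ioo (0 : ℝ) 1 := fun k =>
    ⟨hD.1.diag_pos, lt_one_of_sum_eq_one (by omega) (fun k => hD.1.diag_pos) hD.2 k⟩
  let ℓ : Fin n → Matrix (Fin n) (Fin n) ℝ →ₗ[ℝ] ℝ := fun k => Matrix.entryLinearMap ℝ ℝ k k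
  refine scalarCurvature_coordinatewise (f := f) ℓ (fun k => hf.hasHolomorphicExtension.contDiffAt (hIoo k))
    (fun k => hf.2 _ (hIoo k)) (fun X hX => hX.1.2) (fun X hX h => ?_) (fun v hv => ?_) ?_
  · rw [← hX.2.diagonal_diag, show X.diag = 0 from funext h, Matrix.diagonal_zero']
  · refine ⟨Matrix.diagonal v, ⟨⟨?_, ?_⟩, Matrix.isDiag_diagonal v⟩, fun k =>
      Matrix.diagonal_apply_eq v k⟩
    · exact Matrix.isHermitian_diagonal v
    · rw [Matrix.trace_diagonal, hv]
  · have hev : ∀ᶠ x in 𝓝 (0 : Fin d → ℝ), ∀ k, affineChart b D x k k ∈ Ioo (0 : ℝ) 1 := by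
      refine eventually_all.2 fun k => ?_
      have ht := (contDiff_comp_affineChart (b := b) (p := D) (N := 0) (ℓ k)).continuous.tendsto 0
      rw [affineChart_zero] at ht
      exact ht.eventually (isOpen_Ioo.mem_nhds (hIoo k))
    filter_upwards [hev] with x hx i j
    have hchart : (affineChart b D x).IsDiag := by
      refine hdiag.add ?_
      have : ∑ i, x i • (b i : Matrix (Fin n) (Fin n) ℝ) ∈ diagTangent ℝ n :=
        Submodule.sum_mem _ fun i _ => Submodule.smul_mem _ _ (b i).2
      exact this.2
    exact gf_eq_of_isDiag hchart (b i).2.2 (b j).2.2 fun k =>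
      (hf.hasHolomorphicExtension.contDiffAt (N := 1) (hx k)).differentiableAt (by norm_num)

end Main

end

theorem mainTheorem4 :
    -- the state space of real and of complex matrices, and the space of diagonal states
    (∀ (n : ℕ) (f : ℝ → ℝ), Admissible f →
      (∀ (D : Matrix (Fin n) (Fin n) ℝ) (hD : D ∈ stateSpace ℝ n)
          (d : ℕ) (b : Module.Basis (Fin d) ℝ (stateTangent ℝ n))
          (l : Fin n → ℝ), l = (stateSpace.isHermitian hD).eigenvalues →
        scalarCurvature b (gf f) D =
          4 / cNorm f l ^ 4 * (diagDoubleSum f l - diagSum f l * rhoSum f l)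
            + 1 / cNorm f l ^ 2 * rhoSum f l ^ 2 - 1 / cNorm f l ^ 2 * rhoSqSum f l) ∧
      (∀ (D : Matrix (Fin n) (Fin n) ℂ) (hD : D ∈ stateSpace ℂ n)
          (d : ℕ) (b : Module.Basis (Fin d) ℝ (stateTangent ℂ n))
          (l : Fin n → ℝ), l = (stateSpace.isHermitian hD).eigenvalues →
        scalarCurvature b (gf f) D =
          4 / cNorm f l ^ 4 * (diagDoubleSum f l - 2 * (diagSum f l * rhoSum f l))
            + 4 / cNorm f l ^ 2 * rhoSum f l ^ 2 - 2 / cNorm f l ^ 2 * rhoSqSum f l) ∧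
      (∀ (D : Matrix (Fin n) (Fin n) ℝ), D ∈ stateSpace ℝ n → D.IsDiag →
          ∀ (d : ℕ) (b : Module.Basis (Fin d) ℝ (diagTangent ℝ n)),
        scalarCurvature b (gf f) D = 4 / cNorm f D.diag ^ 4 * diagDoubleSum f D.diag)) ∧
    -- the classical `α`-geometry, for every real `α` (also `α = 1`)
    (∀ (n : ℕ) (α : ℝ) (θ : Fin n → ℝ), θ ∈ probSpace n →
        ∀ (d : ℕ) (b : Module.Basis (Fin d) ℝ (probTangent n))
          (c : ℝ), c = √(∑ k, θ k ^ (α + 1)) →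
      scalarCurvature b (gAlpha α) θ =
        (1 + α) ^ 2 / (4 * c ^ 2) * ∑ t, ∑ s ∈ Finset.univ.erase t,
          θ t ^ α * θ s ^ α * (1 - (θ t ^ (α + 1) + θ s ^ (α + 1)) / c ^ 2)) := by
  refine ⟨fun n f hf => ⟨?_, ?_, ?_⟩, ?_⟩
  · intro D hD d b l hl
    rw [scalarCurvature_stateSpace (κ := Unit) (τ := fun _ => ContinuousLinearMap.id ℝ ℝ)
      (e := fun _ => 1) (fun x y => by simp) (fun k l => by simp) hf hD b hl]
    simp only [Fintype.card_unit, Nat.cast_one, one_mul]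
    ring
  · intro D hD d b l hl
    -- Real and imaginary parts are orthonormal coordinates of `ℂ` with dual basis `1, i`; the two
    -- of them give the factors `2` and `4`.
    rw [scalarCurvature_stateSpace (κ := Bool)
      (τ := fun k => if k then Complex.reCLM else Complex.imCLM)
      (e := fun k => if k then 1 else Complex.I) (fun x y => by simp)
      (fun k l => by cases k <;> cases l <;> simp) hf hD b hl]
    simp only [Fintype.card_bool, Nat.cast_ofNat]
    ring
  · intro D hD hdiag d b
    exact scalarCurvature_diagTangent hf hD hdiag b
  · intro n α θ hθ d b c hc
    exact scalarCurvature_gAlpha α hθ b hc
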